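/- Let $(M,\mathbf g)$ be a smooth Hausdorff $4$-manifold without boundary, with a smooth Lorentzian metric of signature $(-,+,+,+)$ and Levi-Civita connection $\mathbf D$. Let $O\in M$, and let $e_0,e_1,e_2,e_3$ be a basis of $T_OM$ with $\mathbf g(e_\mu,e_\nu)=\mathrm{diag}(-1,1,1,1)_{\mu\nu}$ ($e_0$ is the future direction). Identify $T_OM$ with $\mathbb R^{3+1}$ by $y=y^\mu e_\mu$, and let $\mathbb H_1=\{V: V^0>0,\ (V^0)^2-\sum_{i=1}^3(V^i)^2=1\}$. Let $\exp_O$ be the exponential map at $O$, and let $i_*\in[0,\infty]$ be the supremum of all $s>0$ such that $\exp_O$ is defined on $\{\rho V: 0<\rho<s,\ V\in\mathbb H_1\}$ and is a diffeomorphism from this set onto its image ($i_*=0$ if there is no such $s$). Put $$\mathcal I_*^+(O)=\{\exp_O(\rho V): 0<\rho<i_*,\ V\in\mathbb H_1\},\qquad H_\rho=\exp_O(\rho\,\mathbb H_1)\quad(0<\rho<i_*).$$ On $\mathcal I_*^+(O)$ let $\rho$ be the function with $\rho(\exp_O(\rho V))=\rho$ (the proper time to $O$ along the radial time-like geodesic),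 let $B=-\operatorname{grad}_{\mathbf g}\rho$, and let $R_1,R_2,R_3$ be the boost vector fields $$R_i|_{\exp_O(y)}=(d\exp_O)_y\big(y^i\partial_{y^0}+y^0\partial_{y^i}\big),\qquad i=1,2,3 .$$ For a vector field $X$ let ${}^{(X)}\pi$ be its deformation tensor, ${}^{(X)}\pi(Y,Z)=\mathbf g(\mathbf D_YX,Z)+\mathbf g(\mathbf D_ZX,Y)$. Then, for $i=1,2,3$: 1. $[B,R_i]=0$ on $\mathcal I_*^+(O)$; 2. $R_i$ is tangent to $H_\rho$ at every point of $H_\rho$, for every $0<\rho<i_*$; 3. for every $j\in\{1,2,3\}$, every $n\ge 0$ and all $i_1,\dots,i_n\in\{1,2,3\}$, on $\mathcal I_*^+(O)$, $$\big(\mathcal L_{R_{i_1}}\cdots\mathcal L_{R_{i_n}}{}^{(R_j)}\pi\big)(B,B)=0,\qquad \big(\mathcal L_{R_{i_1}}\cdots\mathcal L_{R_{i_n}}{}^{(R_j)}\pi\big)(B,R_i)=0 ;$$ in particular, with $R=R_j$, $(\mathcal L_R^{n}\,{}^{(R)}\pi)(B,B)=0$ and $(\mathcal L_R^{n}\,{}^{(R)}\pi)(B,R_i)=0$.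 -/

import Mathlib

open scoped ContDiff Manifold ENNReal

noncomputable section

namespace HyperboloidBoost

/-- The components `diag(-1, 1, 1, 1)` of the Minkowski metric. -/
def eta (a b : Fin 4) : ℝ := if a = b then (if a = 0 then -1 else 1) else 0

section Spacetime

variable {E : Type*} [NormedAddCommGroup E] [NormedSpace ℝ E]
  {M : Type*} [TopologicalSpace M] [ChartedSpace E M]

/-- Covariant 2-tensor fields on `M`. -/
abbrev Tensor2 (E : Type*) [NormedAddCommGroup E] [NormedSpace ℝ E]
    (M : Type*) [TopologicalSpace M] [ChartedSpace E M] : Type _ :=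
  (x : M) → TangentSpace 𝓘(ℝ, E) x →L[ℝ] TangentSpace 𝓘(ℝ, E) x →L[ℝ] ℝ

/-- Vector fields on `M`. -/
abbrev VField (E : Type*) [NormedAddCommGroup E] [NormedSpace ℝ E]
    (M : Type*) [TopologicalSpace M] [ChartedSpace E M] : Type _ :=
  (x : M) → TangentSpace 𝓘(ℝ, E) x

/-- A smooth Lorentzian metric of signature `(-,+,+,+)`; in particular `M` has dimension `4`. -/
structure LorentzMetric (E : Type*) [NormedAddCommGroup E] [NormedSpace ℝ E]
    (M : Type*) [TopologicalSpace M] [ChartedSpace E M]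
    [IsManifold 𝓘(ℝ, E) ∞ M] where
  /-- the scalar product on each tangent space -/
  val : Tensor2 E M
  symm : ∀ (x : M) (v w : TangentSpace 𝓘(ℝ, E) x), val x v w = val x w v
  signature : ∀ x : M, ∃ e : Module.Basis (Fin 4) ℝ (TangentSpace 𝓘(ℝ, E) x),
    ∀ a b : Fin 4, val x (e a) (e b) = eta a b
  contMDiff : ContMDiff 𝓘(ℝ, E) (𝓘(ℝ, E).prod 𝓘(ℝ, E →L[ℝ] E →L[ℝ] ℝ)) ∞
    (fun x : M ↦ Bundle.TotalSpace.mk' (E →L[ℝ] E →L[ℝ] ℝ)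
      (E := fun x : M ↦ TangentSpace 𝓘(ℝ, E) x →L[ℝ] TangentSpace 𝓘(ℝ, E) x →L[ℝ] ℝ)
      x (val x))

/-- The expression, in the chart of `M` around `x₀`, of a vector field. -/
def coordVF (x₀ : M) (X : VField E M) : E → E :=
  VectorField.mpullback 𝓘(ℝ, E) 𝓘(ℝ, E) (extChartAt 𝓘(ℝ, E) x₀).symm X

/-- Pullback of a bilinear form by a linear map: `(v, w) ↦ F (A v) (A w)`. -/
def pullbackForm (F : E →L[ℝ] E →L[ℝ] ℝ) (A : E →L[ℝ] E) : E →L[ℝ] E →L[ℝ] ℝ :=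
  F.bilinearComp A A

/-- The expression, in the chart of `M` around `x₀`, of a covariant 2-tensor field. -/
def coordTensor (x₀ : M) (F : Tensor2 E M) (u : E) : E →L[ℝ] E →L[ℝ] ℝ :=
  pullbackForm (F ((extChartAt 𝓘(ℝ, E) x₀).symm u))
    (mfderiv 𝓘(ℝ, E) 𝓘(ℝ, E) (extChartAt 𝓘(ℝ, E) x₀).symm u)

/-- The derivative at `p` of the chart of `M` around `p`. -/
def chartDeriv (p : M) : E →L[ℝ] E :=
  mfderiv 𝓘(ℝ, E) 𝓘(ℝ, E) (extChartAt 𝓘(ℝ, E) p) p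

/-- The Lie derivative `L_X F` of a covariant 2-tensor field, in coordinates
`(L_X F)_{ab} = X^c ∂_c F_{ab} + F_{cb} ∂_a X^c + F_{ac} ∂_b X^c`. -/
def lieDeriv (X : VField E M) (F : Tensor2 E M) : Tensor2 E M := fun p ↦
  let u : E := extChartAt 𝓘(ℝ, E) p p
  let Fu : E →L[ℝ] E →L[ℝ] ℝ := coordTensor p F u
  let DF : E →L[ℝ] E →L[ℝ] E →L[ℝ] ℝ := fderiv ℝ (coordTensor p F) u
  let DX : E →L[ℝ] E := fderiv ℝ (coordVF p X) u
  pullbackForm (E := E) (DF (coordVF p X u) + Fu ∘L DX + (Fu.flip ∘L DX).flip) (chartDeriv p)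

/-- `v` is tangent to the subset `S` of `M` at `p`: it is the velocity at `p` of a smooth curve
in `S`. -/
def IsTangentTo (S : Set M) (p : M) (v : TangentSpace 𝓘(ℝ, E) p) : Prop :=
  ∃ c : ℝ → M, ContMDiffAt 𝓘(ℝ, ℝ) 𝓘(ℝ, E) ∞ c 0 ∧ (∀ᶠ t in nhds (0 : ℝ), c t ∈ S) ∧
    tangentMap 𝓘(ℝ, ℝ) 𝓘(ℝ, E) c ⟨0, (1 : ℝ)⟩ = ⟨p, v⟩

variable [IsManifold 𝓘(ℝ, E) ∞ M]

/-- The Christoffel symbols of the Levi-Civita connection at the point with coordinates `u` in the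
chart around `x₀`: `christoffel g x₀ u w v = Γ(v, w)` is given by
`2 g(Γ(v, w), z) = ∂_v g(w, z) + ∂_w g(v, z) - ∂_z g(w, v)`. -/
def christoffel (g : LorentzMetric E M) (x₀ : M) (u w : E) : E →L[ℝ] E :=
  let D : E →L[ℝ] E →L[ℝ] E →L[ℝ] ℝ := fderiv ℝ (coordTensor x₀ g.val) u
  (1 / 2 : ℝ) • ((coordTensor x₀ g.val u).inverse ∘L (D.flip w + D w - (D.flip w).flip))

/-- The Levi-Civita covariant derivative `v ↦ D_v X` at `p`, in coordinates
`(D_v X)^a = v^b ∂_b X^a + Γ^a_{bc} v^b X^c`. -/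
def covDeriv (g : LorentzMetric E M) (X : VField E M) (p : M) : E →L[ℝ] E :=
  let u : E := extChartAt 𝓘(ℝ, E) p p
  (chartDeriv p).inverse ∘L
    (fderiv ℝ (coordVF p X) u + christoffel g p u (coordVF p X u)) ∘L chartDeriv p

/-- The deformation tensor `π(v, w) = g(D_v X, w) + g(D_w X, v)` of a vector field `X`. -/
def deformation (g : LorentzMetric E M) (X : VField E M) : Tensor2 E M := fun p ↦
  let G : E →L[ℝ] E →L[ℝ] ℝ := g.val p
  let P : E →L[ℝ] E →L[ℝ] ℝ := G ∘L covDeriv g X p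
  P + P.flip

/-- The gradient of a function: `g(grad f, w) = df(w)`. -/
def gradient (g : LorentzMetric E M) (f : M → ℝ) : VField E M := fun p ↦
  (g.val p).inverse (mfderiv 𝓘(ℝ, E) 𝓘(ℝ, ℝ) f p)

/-- `c` is a geodesic on the open set `s ⊆ ℝ` of parameters: it is smooth there and satisfies
`c'' + Γ(c', c') = 0` in the charts of `M`. -/
def IsGeodesicOn (g : LorentzMetric E M) (c : ℝ → M) (s : Set ℝ) : Prop :=
  ContMDiffOn 𝓘(ℝ, ℝ) 𝓘(ℝ, E) ∞ c s ∧
  ∀ t ∈ s, ∀ x₀ : M, c t ∈ (chartAt E x₀).source →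
    let γ : ℝ → E := fun r ↦ extChartAt 𝓘(ℝ, E) x₀ (c r)
    deriv (deriv γ) t + christoffel g x₀ (γ t) (deriv γ t) (deriv γ t) = 0

/-- `c` is a geodesic, defined on a neighbourhood of `[0, 1]`, starting from `O` with velocity
`w`. -/
def IsGeodesicFrom (g : LorentzMetric E M) (O : M) (w : TangentSpace 𝓘(ℝ, E) O) (c : ℝ → M) :
    Prop :=
  (∃ s : Set ℝ, IsOpen s ∧ Set.Icc 0 1 ⊆ s ∧ IsGeodesicOn g c s) ∧
    tangentMap 𝓘(ℝ, ℝ) 𝓘(ℝ, E) c ⟨0, (1 : ℝ)⟩ = ⟨O, w⟩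

/-- The domain of the exponential map at `O`, in the tangent space at `O`. -/
def expDomain (g : LorentzMetric E M) (O : M) : Set E :=
  {w | ∃ c : ℝ → M, IsGeodesicFrom g O w c}

open Classical in
/-- The exponential map at `O`: the value at time `1` of the geodesic starting from `O` with
velocity `w` (and the value `O` where this geodesic does not exist up to time `1`). Its argument is
a tangent vector at `O`; the tangent spaces of `M` have the model space `E` as underlying type. -/
def expMap (g : LorentzMetric E M) (O : M) (w : E) : M :=
  if h : w ∈ expDomain g O then Classical.choose h 1 else O

/-- The components `w^0, …, w^3` of a tangent vector at `O` in the frame `e`. -/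
def comp {O : M} (e : Module.Basis (Fin 4) ℝ (TangentSpace 𝓘(ℝ, E) O)) (w : E) (a : Fin 4) : ℝ :=
  e.repr w a

/-- `(w^0)² - (w^1)² - (w^2)² - (w^3)²` -/
def minkSq {O : M} (e : Module.Basis (Fin 4) ℝ (TangentSpace 𝓘(ℝ, E) O)) (w : E) : ℝ :=
  comp e w 0 ^ 2 - ∑ i : Fin 3, comp e w i.succ ^ 2

/-- The (future) unit hyperboloid in the tangent space at `O`, which the frame `e` identifies with
`ℝ^{3+1}`. -/
def unitHyp {O : M} (e : Module.Basis (Fin 4) ℝ (TangentSpace 𝓘(ℝ, E) O)) : Set E :=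
  {V | 0 < comp e V 0 ∧ minkSq e V = 1}

/-- The set of all `r V` with `0 < r < s` and `V` in the unit hyperboloid. -/
def hypCone {O : M} (e : Module.Basis (Fin 4) ℝ (TangentSpace 𝓘(ℝ, E) O)) (s : ℝ≥0∞) : Set E :=
  {w | ∃ r : ℝ, ∃ V ∈ unitHyp e, 0 < r ∧ ENNReal.ofReal r < s ∧ w = r • V}

/-- The exponential map at `O` is defined on, and is a diffeomorphism onto its image from, the set
of all `r V` with `0 < r < s` and `V` in the unit hyperboloid. -/
def ExpIsDiffeoUpTo (g : LorentzMetric E M) {O : M}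
    (e : Module.Basis (Fin 4) ℝ (TangentSpace 𝓘(ℝ, E) O)) (s : ℝ) : Prop :=
  hypCone e (ENNReal.ofReal s) ⊆ expDomain g O ∧
  ∃ Φ : PartialDiffeomorph 𝓘(ℝ, E) 𝓘(ℝ, E) E M ∞,
    Φ.source = hypCone e (ENNReal.ofReal s) ∧
    Set.EqOn Φ (expMap g O) (hypCone e (ENNReal.ofReal s))

/-- The time-like radius of injectivity `i_*` of `O`, in `[0, ∞]`. -/
def injRadius (g : LorentzMetric E M) {O : M}
    (e : Module.Basis (Fin 4) ℝ (TangentSpace 𝓘(ℝ, E) O)) : ℝ≥0∞ :=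
  sSup {r | ∃ s : ℝ, 0 < s ∧ ExpIsDiffeoUpTo g e s ∧ r = ENNReal.ofReal s}

/-- The part of the chronological future of `O` within the time-like radius of injectivity. -/
def futureStar (g : LorentzMetric E M) {O : M}
    (e : Module.Basis (Fin 4) ℝ (TangentSpace 𝓘(ℝ, E) O)) : Set M :=
  expMap g O '' hypCone e (injRadius g e)

/-- The intrinsic hyperboloid `H_r`, the image of `r` times the unit hyperboloid under the
exponential map. -/
def hyp (g : LorentzMetric E M) {O : M}
    (e : Module.Basis (Fin 4) ℝ (TangentSpace 𝓘(ℝ, E) O)) (r : ℝ) : Set M :=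
  (fun V ↦ expMap g O (r • V)) '' unitHyp e

/-- The inverse of the exponential map on `futureStar`. The components of `expInv g e p` in the
frame `e` are the geodesic normal coordinates of `p`. -/
def expInv (g : LorentzMetric E M) {O : M}
    (e : Module.Basis (Fin 4) ℝ (TangentSpace 𝓘(ℝ, E) O)) : M → E :=
  Function.invFunOn (expMap g O) (hypCone e (injRadius g e))

/-- The geodesic distance `ρ` to `O` on `futureStar`: for `p = exp_O(r V)` with `V` in the unit
hyperboloid, it is the proper time `r` from `O` to `p` along the geodesic `r ↦ exp_O(r V)`. -/
def rho (g : LorentzMetric E M) {O : M}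
    (e : Module.Basis (Fin 4) ℝ (TangentSpace 𝓘(ℝ, E) O)) (p : M) : ℝ :=
  Real.sqrt (minkSq e (expInv g e p))

/-- The vector field `B = - grad ρ`. -/
def normalB (g : LorentzMetric E M) {O : M}
    (e : Module.Basis (Fin 4) ℝ (TangentSpace 𝓘(ℝ, E) O)) : VField E M :=
  fun p ↦ -gradient g (rho g e) p

/-- The boost `y^i ∂_0 + y^0 ∂_i` of the Minkowski space `ℝ^{3+1}` (the tangent space at `O`); the
index `i : Fin 3` stands for the spatial coordinate `y^{i+1}`. -/
def flatBoost {O : M} (e : Module.Basis (Fin 4) ℝ (TangentSpace 𝓘(ℝ, E) O)) (i : Fin 3)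
    (y : E) : E :=
  let f : Fin 4 → E := fun a ↦ e a
  comp e y i.succ • f 0 + comp e y 0 • f i.succ

/-- The boost vector field `R_i`, the push-forward of the flat boost under the exponential map: at
`p = exp_O(y)` it is `(d exp_O)_y (y^i ∂_0 + y^0 ∂_i)`. -/
def boost (g : LorentzMetric E M) {O : M}
    (e : Module.Basis (Fin 4) ℝ (TangentSpace 𝓘(ℝ, E) O)) (i : Fin 3) : VField E M :=
  fun p ↦ mfderiv 𝓘(ℝ, E) 𝓘(ℝ, E) (expMap g O) (expInv g e p)
    (flatBoost (E := E) e i (expInv g e p))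

/-- The iterated Lie derivative `L_{R_{i_1}} ⋯ L_{R_{i_n}} F` along boosts, for the list
`[i_1, …, i_n]`. -/
def iterLie (g : LorentzMetric E M) {O : M}
    (e : Module.Basis (Fin 4) ℝ (TangentSpace 𝓘(ℝ, E) O)) (l : List (Fin 3))
    (F : Tensor2 E M) : Tensor2 E M :=
  l.foldr (fun i G ↦ lieDeriv (boost g e i) G) F

end Spacetime

end HyperboloidBoost

end

/-! Everything is pulled back by `exp_O` to the cone in `T_O M`, that is, to normal coordinates `y`.
Write `G` for the pulled-back metric and `η` for the scalar product at `O`. There the boost `R_i` is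
a linear field `A_i` that is skew for `η` (`boostMap_antisymm`).

The central fact is the Gauss lemma `G_y(y, z) = η(y, z)` (`IsExpChart.gauss`). Since `ρ² = -η(y,
y)`, it shows that `B = -grad ρ` corresponds to the unit radial field `y / ρ`
(`IsConeChart.normalB_eq`).

Claim 1: `A_i` is linear and `ρ` is constant along `A_i`, because `η(y, A_i y) = 0`; hence `[y / ρ,
A_i] = 0`, and brackets are natural under `exp_O` (`mlieBracket_of_related`). Claim 2: for `V` in
the unit hyperboloid, the line `V + t A_i V`, normalized, stays in the hyperboloid and has velocity
`A_i V` at `t = 0`. Claim 3: the deformation tensor of `R_j` is `L_{R_j} g`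
(`deformation_eq_lieDeriv`). If `F_y(y, ·) = ζ(y, ·)` for a constant form `ζ`, then `(L_A F)_y(y, z)
= ζ(A y, z) + ζ(y, A z)` for linear `A` (`flatLie_self_apply`). With `F = G` and `ζ = η` this
vanishes by skewness; every later Lie derivative is the case `ζ = 0`. So all the tensors annihilate
`B` in the first slot, whatever the second argument.

The Gauss lemma is proved by integrating the geodesic equation along rays from the origin. The cone
does not contain the origin, so the limit at the origin rests on a Lipschitz bound for `exp_O` near
`0`, obtained from Picard–Lindelöf (`exists_lipschitzOnWith_expMap`). -/

open scoped Topology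

noncomputable section

namespace HyperboloidBoost

/-! ### Pullbacks and Lie derivatives of bilinear forms on a vector space. -/

section Flat

variable {E : Type*} [NormedAddCommGroup E] [NormedSpace ℝ E]

/-- The pullback of a field of bilinear forms on a normed space by a map. -/
def flatPull (θ : E → E) (F : E → E →L[ℝ] E →L[ℝ] ℝ) (u : E) : E →L[ℝ] E →L[ℝ] ℝ :=
  pullbackForm (F (θ u)) (fderiv ℝ θ u)

/-- The Lie derivative of a field of bilinear forms on a normed space. -/
def flatLie (X : E → E) (F : E → E →L[ℝ] E →L[ℝ] ℝ) (u : E) : E →L[ℝ] E →L[ℝ] ℝ :=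
  fderiv ℝ F u (X u) + F u ∘L fderiv ℝ X u + ((F u).flip ∘L fderiv ℝ X u).flip

@[simp]
theorem pullbackForm_apply (F : E →L[ℝ] E →L[ℝ] ℝ) (A : E →L[ℝ] E) (v w : E) :
    pullbackForm F A v w = F (A v) (A w) := rfl

theorem flatPull_apply (θ : E → E) (F : E → E →L[ℝ] E →L[ℝ] ℝ) (u v w : E) :
    flatPull θ F u v w = F (θ u) (fderiv ℝ θ u v) (fderiv ℝ θ u w) := rfl

theorem flatLie_apply (X : E → E) (F : E → E →L[ℝ] E →L[ℝ] ℝ) (u v w : E) :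
    flatLie X F u v w =
      fderiv ℝ F u (X u) v w + F u (fderiv ℝ X u v) w + F u v (fderiv ℝ X u w) := rfl

theorem contDiff_flip {F G : Type*} [NormedAddCommGroup F] [NormedSpace ℝ F]
    [NormedAddCommGroup G] [NormedSpace ℝ G] {n : WithTop ℕ∞} :
    ContDiff ℝ n (fun L : E →L[ℝ] F →L[ℝ] G ↦ L.flip) :=
  LinearIsometryEquiv.contDiff (𝕜 := ℝ) (E := E →L[ℝ] F →L[ℝ] G) (F := F →L[ℝ] E →L[ℝ] G)
    (ContinuousLinearMap.flipₗᵢ ℝ E F G)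

theorem ContDiffAt.flip {D F G : Type*} [NormedAddCommGroup D] [NormedSpace ℝ D]
    [NormedAddCommGroup F] [NormedSpace ℝ F] [NormedAddCommGroup G] [NormedSpace ℝ G]
    {n : WithTop ℕ∞} {K : D → E →L[ℝ] F →L[ℝ] G} {q : D} (hK : ContDiffAt ℝ n K q) :
    ContDiffAt ℝ n (fun q ↦ (K q).flip) q :=
  ContDiffAt.comp (𝕜 := ℝ) (g := fun L : E →L[ℝ] F →L[ℝ] G ↦ L.flip) (f := K) q
    contDiff_flip.contDiffAt hK

theorem pullbackForm_eq (F : E →L[ℝ] E →L[ℝ] ℝ) (A : E →L[ℝ] E) :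
    pullbackForm F A = ((F ∘L A).flip ∘L A).flip := rfl

theorem differentiableAt_pullbackForm {F : E → E →L[ℝ] E →L[ℝ] ℝ} {A : E → E →L[ℝ] E} {u : E}
    (hF : DifferentiableAt ℝ F u) (hA : DifferentiableAt ℝ A u) :
    DifferentiableAt ℝ (fun w ↦ pullbackForm (F w) (A w)) u := by
  have hflip : Differentiable ℝ (fun F : E →L[ℝ] E →L[ℝ] ℝ ↦ F.flip) :=
    contDiff_flip.differentiable (n := 1) (by norm_num)
  simp only [pullbackForm_eq]
  have h0 : ∀ {K : E → E →L[ℝ] E →L[ℝ] ℝ}, DifferentiableAt ℝ K u →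
      DifferentiableAt ℝ (fun w ↦ (K w).flip) u := fun {K} hK ↦
    DifferentiableAt.comp (𝕜 := ℝ) (F := E →L[ℝ] E →L[ℝ] ℝ) (G := E →L[ℝ] E →L[ℝ] ℝ)
      (g := fun F ↦ F.flip) (f := K) u (hflip (K u)) hK
  exact h0 (DifferentiableAt.clm_comp (h0 (hF.clm_comp hA)) hA)

theorem differentiableAt_fderiv {θ : E → E} {u : E} (hθ : ContDiffAt ℝ 2 θ u) :
    DifferentiableAt ℝ (fderiv ℝ θ) u :=
  (hθ.fderiv_right (m := 1) (by norm_num)).differentiableAt (by norm_num)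

theorem differentiableAt_flatPull {θ : E → E} {F : E → E →L[ℝ] E →L[ℝ] ℝ} {u : E}
    (hθ : ContDiffAt ℝ 2 θ u) (hF : DifferentiableAt ℝ F (θ u)) :
    DifferentiableAt ℝ (flatPull θ F) u :=
  differentiableAt_pullbackForm
    (DifferentiableAt.comp (g := F) u hF (hθ.differentiableAt (by norm_num)))
    (differentiableAt_fderiv hθ)

/-- Evaluation of the derivative of a field of bilinear forms. -/
theorem fderiv_form_apply {F : E → E →L[ℝ] E →L[ℝ] ℝ} {u : E} (hF : DifferentiableAt ℝ F u)
    (v a b : E) : fderiv ℝ F u v a b = fderiv ℝ (fun w ↦ F w a b) u v := by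
  have h1 := (hF.hasFDerivAt.clm_apply (hasFDerivAt_const a u)).clm_apply (hasFDerivAt_const b u)
  rw [h1.fderiv]
  simp

/-- Product rule: the base point and the two slots each contribute. The terms with the second
derivative of `θ` are the non-tensorial ones, which must cancel in a Lie derivative. -/
theorem fderiv_flatPull {θ : E → E} {F : E → E →L[ℝ] E →L[ℝ] ℝ} {u : E}
    (hθ : ContDiffAt ℝ 2 θ u) (hF : DifferentiableAt ℝ F (θ u)) (v a b : E) :
    fderiv ℝ (flatPull θ F) u v a b =
      fderiv ℝ F (θ u) (fderiv ℝ θ u v) (fderiv ℝ θ u a) (fderiv ℝ θ u b)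
      + F (θ u) (fderiv ℝ (fderiv ℝ θ) u v a) (fderiv ℝ θ u b)
      + F (θ u) (fderiv ℝ θ u a) (fderiv ℝ (fderiv ℝ θ) u v b) := by
  rw [fderiv_form_apply (differentiableAt_flatPull hθ hF)]
  have hθ1 := (hθ.differentiableAt (by norm_num)).hasFDerivAt
  have hθ2 := (differentiableAt_fderiv hθ).hasFDerivAt
  have hA : ∀ c : E, HasFDerivAt (fun w ↦ fderiv ℝ θ w c) _ u := fun c ↦
    hθ2.clm_apply (hasFDerivAt_const c u)
  have hc : HasFDerivAt (F ∘ θ) (fderiv ℝ F (θ u) ∘L fderiv ℝ θ u) u :=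
    HasFDerivAt.comp (g := F) u hF.hasFDerivAt hθ1
  have h1 := (hc.clm_apply (hA a)).clm_apply (hA b)
  have h2 : (fun w ↦ flatPull θ F w a b) =
      fun w ↦ (F ∘ θ) w (fderiv ℝ θ w a) (fderiv ℝ θ w b) := rfl
  rw [h2, h1.fderiv]
  simp
  ring

/-- The Lie derivative commutes with pullbacks. -/
theorem flatLie_flatPull {θ X X' : E → E} {F : E → E →L[ℝ] E →L[ℝ] ℝ} {u : E}
    (hθ : ContDiffAt ℝ 2 θ u) (hF : DifferentiableAt ℝ F (θ u))
    (hX : DifferentiableAt ℝ X (θ u)) (hX' : DifferentiableAt ℝ X' u)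
    (h : ∀ᶠ w in 𝓝 u, fderiv ℝ θ w (X' w) = X (θ w)) :
    flatLie X' (flatPull θ F) u = pullbackForm (flatLie X F (θ u)) (fderiv ℝ θ u) := by
  have hθ1 := (hθ.differentiableAt (by norm_num)).hasFDerivAt
  have hθ2 := (differentiableAt_fderiv hθ).hasFDerivAt
  have hsymm : ∀ v w, fderiv ℝ (fderiv ℝ θ) u v w = fderiv ℝ (fderiv ℝ θ) u w v :=
    hθ.isSymmSndFDerivAt (by simp)
  -- The relation `h`, differentiated in the direction `v`. With the symmetry of the second
  -- derivative it absorbs the second-order terms of `fderiv_flatPull`.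
  have key : ∀ v, fderiv ℝ (fderiv ℝ θ) u v (X' u) + fderiv ℝ θ u (fderiv ℝ X' u v)
      = fderiv ℝ X (θ u) (fderiv ℝ θ u v) := by
    intro v
    have h1 := hθ2.clm_apply hX'.hasFDerivAt
    have h2 := hX.hasFDerivAt.comp u hθ1
    have h3 := h1.congr_of_eventuallyEq (f₁ := X ∘ θ) (h.mono fun w hw ↦ hw.symm)
    have h4 := congrArg (fun A ↦ A v) (h3.unique h2)
    simp at h4
    rw [← h4]
    abel
  ext a b
  rw [flatLie_apply, fderiv_flatPull hθ hF, pullbackForm_apply, flatLie_apply, flatPull_apply,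
    flatPull_apply, ← key a, ← key b, h.self_of_nhds, hsymm (X' u) a, hsymm (X' u) b]
  simp only [map_add, add_apply]
  ring

theorem contDiffAt_flatLie {X : E → E} {F : E → E →L[ℝ] E →L[ℝ] ℝ} {u : E}
    (hX : ContDiffAt ℝ ∞ X u) (hF : ContDiffAt ℝ ∞ F u) :
    ContDiffAt ℝ ∞ (flatLie X F) u := by
  have hX' := hX.fderiv_right (m := ∞) (by simp)
  have hF' := hF.fderiv_right (m := ∞) (by simp)
  exact ((hF'.clm_apply hX).add (hF.clm_comp hX')).add
    (contDiff_flip.contDiffAt.comp u ((contDiff_flip.contDiffAt.comp u hF).clm_comp hX'))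

theorem flatLie_congr {X : E → E} {F G : E → E →L[ℝ] E →L[ℝ] ℝ} {u : E}
    (h : F =ᶠ[𝓝 u] G) : flatLie X F u = flatLie X G u := by
  rw [flatLie, flatLie, h.fderiv_eq, h.self_of_nhds]

/-- If `F_y(y, z) = η(y, z)` near `u`, then the Lie derivative along a linear field `A` satisfies
`(L_A F)_u(u, z) = η(A u, z) + η(u, A z)`. -/
theorem flatLie_self_apply {A : E →L[ℝ] E} {F : E → E →L[ℝ] E →L[ℝ] ℝ} {η : E →L[ℝ] E →L[ℝ] ℝ}
    {u : E} (hF : DifferentiableAt ℝ F u) (h : ∀ᶠ y in 𝓝 u, ∀ z, F y y z = η y z) (z : E) :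
    flatLie A F u u z = η (A u) z + η u (A z) := by
  -- Differentiate `F y y z = η y z` along `A u`. The moving first slot yields `F u (A u) z`, which
  -- is also the first-slot term of the Lie derivative, since `A` is its own derivative.
  have h1 := (hF.hasFDerivAt.clm_apply (hasFDerivAt_id u)).clm_apply (hasFDerivAt_const z u)
  have h2 : HasFDerivAt (fun y ↦ η y z) _ u :=
    (η.hasFDerivAt (x := u)).clm_apply (hasFDerivAt_const z u)
  have h3 := h1.congr_of_eventuallyEq (f₁ := fun y ↦ η y z) (h.mono fun w hw ↦ (hw z).symm)
  have h4 := congrArg (fun B ↦ B (A u)) (h3.unique h2)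
  simp at h4
  rw [flatLie_apply, ContinuousLinearMap.fderiv, h.self_of_nhds (A z)]
  rw [← h4]
  ring

end Flat

/-! ### Tensor fields on `M` pulled back to the model space. -/

section Charts

variable {E : Type*} [NormedAddCommGroup E] [NormedSpace ℝ E]
  {M : Type*} [TopologicalSpace M] [ChartedSpace E M]

/-- The pullback of a covariant 2-tensor field on `M` by a map from the model space to `M`. -/
def pullTensor (f : E → M) (F : Tensor2 E M) (u : E) : E →L[ℝ] E →L[ℝ] ℝ :=
  pullbackForm (F (f u)) (mfderiv 𝓘(ℝ, E) 𝓘(ℝ, E) f u)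

/-- The derivative of a map from the model space to `M`, as an endomorphism of the model space. -/
def modelDeriv (f : E → M) (u : E) : E →L[ℝ] E := mfderiv 𝓘(ℝ, E) 𝓘(ℝ, E) f u

theorem pullTensor_apply (f : E → M) (F : Tensor2 E M) (u a b : E) :
    pullTensor f F u a b = F (f u) (modelDeriv f u a) (modelDeriv f u b) := rfl

theorem coordTensor_eq_pullTensor (x₀ : M) (F : Tensor2 E M) :
    coordTensor x₀ F = pullTensor (extChartAt 𝓘(ℝ, E) x₀).symm F := rfl

theorem lieDeriv_eq (X : VField E M) (F : Tensor2 E M) (p : M) :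
    lieDeriv X F p = pullbackForm (E := E)
      (flatLie (coordVF p X) (coordTensor p F) (extChartAt 𝓘(ℝ, E) p p)) (chartDeriv p) := rfl

theorem pullTensor_congr {f f' : E → M} {F : Tensor2 E M} {u : E} (h : f =ᶠ[𝓝 u] f') :
    pullTensor f F u = pullTensor f' F u := by
  have h1 : modelDeriv f u = modelDeriv f' u := h.mfderiv_eq
  -- The type of `F (f u)` depends on `f u`, so the base point and the derivative are generalized
  -- before substituting.
  have h2 : ∀ x : M, x = f u → ∀ A : E →L[ℝ] E, A = modelDeriv f u →
      pullTensor f F u = pullbackForm (E := E) (F x) A := by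
    rintro _ rfl _ rfl
    rfl
  exact h2 _ h.self_of_nhds.symm _ h1.symm

theorem modelDeriv_comp {f : E → M} {θ : E → E} {u : E}
    (hf : MDifferentiableAt 𝓘(ℝ, E) 𝓘(ℝ, E) f (θ u)) (hθ : DifferentiableAt ℝ θ u) :
    modelDeriv (f ∘ θ) u = modelDeriv f (θ u) ∘L fderiv ℝ θ u := by
  have := mfderiv_comp u hf hθ.mdifferentiableAt
  rw [mfderiv_eq_fderiv] at this
  exact this

theorem pullTensor_comp {f : E → M} {θ : E → E} {F : Tensor2 E M} {u : E}
    (hf : MDifferentiableAt 𝓘(ℝ, E) 𝓘(ℝ, E) f (θ u)) (hθ : DifferentiableAt ℝ θ u) :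
    pullTensor (f ∘ θ) F u = flatPull θ (pullTensor f F) u := by
  ext a b
  rw [pullTensor_apply, modelDeriv_comp hf hθ]
  rfl

theorem extChartAt_symm_comp_eventuallyEq {f : E → M} {x₀ : M} {u : E}
    (hf : ContinuousAt f u) (hu : f u ∈ (chartAt E x₀).source) :
    (extChartAt 𝓘(ℝ, E) x₀).symm ∘ (fun w ↦ extChartAt 𝓘(ℝ, E) x₀ (f w)) =ᶠ[𝓝 u] f := by
  filter_upwards [hf ((chartAt E x₀).open_source.mem_nhds hu)] with w hw
  exact (extChartAt 𝓘(ℝ, E) x₀).left_inv (by rwa [extChartAt_source])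

variable [IsManifold 𝓘(ℝ, E) ∞ M]

theorem contMDiffAt_extChartAt_symm {x₀ : M} {u : E} (hu : u ∈ (extChartAt 𝓘(ℝ, E) x₀).target) :
    ContMDiffAt 𝓘(ℝ, E) 𝓘(ℝ, E) ∞ (extChartAt 𝓘(ℝ, E) x₀).symm u :=
  (contMDiffOn_extChartAt_symm x₀ u hu).contMDiffAt ((isOpen_extChartAt_target x₀).mem_nhds hu)

theorem mdifferentiableAt_extChartAt_symm {x₀ : M} {u : E}
    (hu : u ∈ (extChartAt 𝓘(ℝ, E) x₀).target) :
    MDifferentiableAt 𝓘(ℝ, E) 𝓘(ℝ, E) (extChartAt 𝓘(ℝ, E) x₀).symm u :=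
  (contMDiffAt_extChartAt_symm hu).mdifferentiableAt (by simp)

/-- The tangent space at `p` is by construction the model space seen through the preferred chart at
`p`; `chartDeriv` therefore drops out of all formulas. -/
theorem chartDeriv_eq_id (p : M) : chartDeriv (E := E) p = ContinuousLinearMap.id ℝ E :=
  mfderiv_extChartAt_self

theorem modelDeriv_extChartAt_symm_self (p : M) :
    modelDeriv (extChartAt 𝓘(ℝ, E) p).symm (extChartAt 𝓘(ℝ, E) p p) =
      ContinuousLinearMap.id ℝ E := by
  have := mfderivWithin_range_extChartAt_symm (I := 𝓘(ℝ, E)) (x := p)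
  simp only [modelWithCornersSelf_coe, Set.range_id, mfderivWithin_univ] at this
  exact this

theorem differentiableAt_extChartAt_comp {f : E → M} {x₀ : M} {u : E}
    (hf : MDifferentiableAt 𝓘(ℝ, E) 𝓘(ℝ, E) f u) (hu : f u ∈ (chartAt E x₀).source) :
    DifferentiableAt ℝ (fun w ↦ extChartAt 𝓘(ℝ, E) x₀ (f w)) u :=
  ((mdifferentiableAt_extChartAt (I := 𝓘(ℝ, E)) hu).comp u hf).differentiableAt

theorem contDiffAt_extChartAt_comp {f : E → M} {x₀ : M} {u : E}
    (hf : ContMDiffAt 𝓘(ℝ, E) 𝓘(ℝ, E) ∞ f u) (hu : f u ∈ (chartAt E x₀).source) :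
    ContDiffAt ℝ ∞ (fun w ↦ extChartAt 𝓘(ℝ, E) x₀ (f w)) u :=
  ((contMDiffAt_extChartAt' (I := 𝓘(ℝ, E)) hu).comp u hf).contDiffAt

theorem modelDeriv_eq_comp {f : E → M} {x₀ : M} {u : E}
    (hf : MDifferentiableAt 𝓘(ℝ, E) 𝓘(ℝ, E) f u) (hu : f u ∈ (chartAt E x₀).source) :
    modelDeriv f u = modelDeriv (extChartAt 𝓘(ℝ, E) x₀).symm (extChartAt 𝓘(ℝ, E) x₀ (f u)) ∘L
      fderiv ℝ (fun w ↦ extChartAt 𝓘(ℝ, E) x₀ (f w)) u := by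
  have hu' : extChartAt 𝓘(ℝ, E) x₀ (f u) ∈ (extChartAt 𝓘(ℝ, E) x₀).target :=
    (extChartAt 𝓘(ℝ, E) x₀).map_source (by rwa [extChartAt_source])
  have h1 := modelDeriv_comp (θ := fun w ↦ extChartAt 𝓘(ℝ, E) x₀ (f w))
    (mdifferentiableAt_extChartAt_symm hu') (differentiableAt_extChartAt_comp hf hu)
  rw [← h1]
  exact (extChartAt_symm_comp_eventuallyEq hf.continuousAt hu).symm.mfderiv_eq

/-- Locally `f` is the inverse chart composed with `f` read in the chart, so pullbacks from `M`
reduce to vector-space pullbacks of the coordinate expression. -/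
theorem pullTensor_eq_flatPull {f : E → M} {F : Tensor2 E M} {x₀ : M} {u : E}
    (hf : MDifferentiableAt 𝓘(ℝ, E) 𝓘(ℝ, E) f u) (hu : f u ∈ (chartAt E x₀).source) :
    pullTensor f F u =
      flatPull (fun w ↦ extChartAt 𝓘(ℝ, E) x₀ (f w)) (coordTensor x₀ F) u := by
  have hu' : extChartAt 𝓘(ℝ, E) x₀ (f u) ∈ (extChartAt 𝓘(ℝ, E) x₀).target :=
    (extChartAt 𝓘(ℝ, E) x₀).map_source (by rwa [extChartAt_source])
  rw [← pullTensor_congr (extChartAt_symm_comp_eventuallyEq hf.continuousAt hu),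
    pullTensor_comp (mdifferentiableAt_extChartAt_symm hu')
    (differentiableAt_extChartAt_comp hf hu), coordTensor_eq_pullTensor]

/-- The pullback of the metric by a smooth map is smooth. -/
theorem contDiffAt_pullTensor [FiniteDimensional ℝ E] (g : LorentzMetric E M) {f : E → M}
    {s : Set E} (hs : IsOpen s) (hf : ContMDiffOn 𝓘(ℝ, E) 𝓘(ℝ, E) ∞ f s) {u : E} (hu : u ∈ s) :
    ContDiffAt ℝ ∞ (pullTensor f g.val) u := by
  refine ContDiffOn.contDiffAt (s := s) ?_ (hs.mem_nhds hu)
  rw [contDiffOn_clm_apply]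
  intro a
  rw [contDiffOn_clm_apply]
  intro b
  -- In finite dimension it suffices to treat the scalars `g(df a, df b)`; the tangent map exhibits
  -- `w ↦ df_w c` as a smooth section along `f`.
  have hT := hf.contMDiffOn_tangentMapWithin (m := ∞) (by simp) hs.uniqueMDiffOn
  have hV : ∀ c : E, ContMDiffOn 𝓘(ℝ, E) 𝓘(ℝ, E).tangent ∞
      (fun w ↦ Bundle.TotalSpace.mk' E (E := TangentSpace 𝓘(ℝ, E) (M := M)) (f w)
        (modelDeriv f w c)) s := by
    intro c
    have h1 : ContMDiff 𝓘(ℝ, E) 𝓘(ℝ, E).tangent ∞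
        (fun w : E ↦ (⟨w, c⟩ : TangentBundle 𝓘(ℝ, E) E)) := by
      intro w
      rw [Bundle.contMDiffAt_totalSpace]
      refine ⟨contMDiffAt_id, ?_⟩
      simpa using contMDiffAt_const
    have h2 := hT.comp (h1.contMDiffOn (s := s)) (fun w hw ↦ hw)
    refine h2.congr fun w hw ↦ ?_
    simp only [Function.comp, tangentMapWithin]
    rw [mfderivWithin_eq_mfderiv (hs.uniqueMDiffOn w hw)
      ((hf.contMDiffAt (hs.mem_nhds hw)).mdifferentiableAt (by simp))]
    rfl
  have hg := g.contMDiff.comp_contMDiffOn hf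
  have h3 : ContMDiffOn 𝓘(ℝ, E) (𝓘(ℝ, E).prod 𝓘(ℝ, ℝ)) ∞
      (fun w ↦ Bundle.TotalSpace.mk' ℝ (E := Bundle.Trivial M ℝ) (f w)
        (g.val (f w) (modelDeriv f w a) (modelDeriv f w b))) s := by
    apply ContMDiffOn.clm_bundle_apply₂ (F₁ := E) (F₂ := E)
    · exact hg
    · exact hV a
    · exact hV b
  intro w hw
  have h4 := h3 w hw
  rw [Bundle.contMDiffWithinAt_totalSpace] at h4
  exact h4.2.contDiffWithinAt

theorem contDiffAt_coordTensor [FiniteDimensional ℝ E] (g : LorentzMetric E M) {x₀ : M} {u : E}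
    (hu : u ∈ (extChartAt 𝓘(ℝ, E) x₀).target) :
    ContDiffAt ℝ ∞ (coordTensor x₀ g.val) u :=
  contDiffAt_pullTensor g (isOpen_extChartAt_target x₀) (contMDiffOn_extChartAt_symm x₀) hu

end Charts

/-! ### Naturality of the Lie derivative under local diffeomorphisms. -/

section Charts

variable {E : Type*} [NormedAddCommGroup E] [NormedSpace ℝ E]
  {M : Type*} [TopologicalSpace M] [ChartedSpace E M] [IsManifold 𝓘(ℝ, E) ∞ M]

theorem isInvertible_modelDeriv_extChartAt_symm {x₀ : M} {u : E}
    (hu : u ∈ (extChartAt 𝓘(ℝ, E) x₀).target) :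
    (modelDeriv (extChartAt 𝓘(ℝ, E) x₀).symm u).IsInvertible := by
  have := isInvertible_mfderivWithin_extChartAt_symm (I := 𝓘(ℝ, E)) hu
  simp only [modelWithCornersSelf_coe, Set.range_id, mfderivWithin_univ] at this
  exact this

/-- Reads the relation `df v = X` in a chart: the inverse in the definition of `coordVF` cancels the
first factor of `modelDeriv_eq_comp`. -/
theorem coordVF_apply_eq {f : E → M} {x₀ : M} {X : VField E M} {w v : E}
    (hf : MDifferentiableAt 𝓘(ℝ, E) 𝓘(ℝ, E) f w) (hw : f w ∈ (chartAt E x₀).source)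
    (hX : modelDeriv f w v = X (f w)) :
    coordVF x₀ X (extChartAt 𝓘(ℝ, E) x₀ (f w)) =
      fderiv ℝ (fun w ↦ extChartAt 𝓘(ℝ, E) x₀ (f w)) w v := by
  have hw' : f w ∈ (extChartAt 𝓘(ℝ, E) x₀).source := by rwa [extChartAt_source]
  have hu' := (extChartAt 𝓘(ℝ, E) x₀).map_source hw'
  have hinv := isInvertible_modelDeriv_extChartAt_symm hu'
  have h1 : coordVF x₀ X (extChartAt 𝓘(ℝ, E) x₀ (f w)) =
      (modelDeriv (extChartAt 𝓘(ℝ, E) x₀).symm (extChartAt 𝓘(ℝ, E) x₀ (f w))).inverse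
        ((X : M → E) ((extChartAt 𝓘(ℝ, E) x₀).symm (extChartAt 𝓘(ℝ, E) x₀ (f w)))) := rfl
  have hX' : (X : M → E) (f w) = modelDeriv f w v := hX.symm
  rw [h1, (extChartAt 𝓘(ℝ, E) x₀).left_inv hw', hX', modelDeriv_eq_comp hf hw]
  exact hinv.inverse_apply_self _

/-- The Lie derivative is natural under local diffeomorphisms. -/
theorem pullTensor_lieDeriv (Φ : PartialDiffeomorph 𝓘(ℝ, E) 𝓘(ℝ, E) E M ∞) {X : VField E M}
    {X' : E → E} {F : Tensor2 E M} {y : E} (hy : y ∈ Φ.source)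
    (hF : DifferentiableAt ℝ (pullTensor Φ F) y) (hX' : DifferentiableAt ℝ X' y)
    (hX : ∀ᶠ w in 𝓝 y, modelDeriv Φ w (X' w) = X (Φ w)) :
    pullTensor Φ (lieDeriv X F) y = flatLie X' (pullTensor Φ F) y := by
  set p : M := Φ y with hp
  set θ : E → E := fun w ↦ extChartAt 𝓘(ℝ, E) p (Φ w) with hθ
  set u : E := extChartAt 𝓘(ℝ, E) p p with hu
  have hu_eq : θ y = u := rfl
  have hΦ : ∀ w ∈ Φ.source, ContMDiffAt 𝓘(ℝ, E) 𝓘(ℝ, E) ∞ Φ w := fun w hw ↦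
    Φ.contMDiffOn_toFun.contMDiffAt (Φ.open_source.mem_nhds hw)
  have hΦd : ∀ w ∈ Φ.source, MDifferentiableAt 𝓘(ℝ, E) 𝓘(ℝ, E) Φ w := fun w hw ↦
    (hΦ w hw).mdifferentiableAt (by simp)
  have hsrc : ∀ᶠ w in 𝓝 y, w ∈ Φ.source := Φ.open_source.mem_nhds hy
  have hps : p ∈ (chartAt E p).source := mem_chart_source E p
  have hpt : u ∈ (extChartAt 𝓘(ℝ, E) p).target := mem_extChartAt_target p
  have hchart : ∀ᶠ w in 𝓝 y, Φ w ∈ (chartAt E p).source :=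
    (hΦ y hy).continuousAt ((chartAt E p).open_source.mem_nhds hps)
  -- The local inverse of `θ`. Regularity is assumed only for the pullback of `F` and for `X'`;
  -- through `τ` it passes to the coordinate expressions of `F` and `X`.
  set τ : E → E := fun v ↦ Φ.symm ((extChartAt 𝓘(ℝ, E) p).symm v) with hτ
  have hsymmu : (extChartAt 𝓘(ℝ, E) p).symm u = p := extChartAt_to_inv p
  have hpT : p ∈ Φ.target := Φ.map_source hy
  have hτu : τ u = y := by
    simp only [hτ, hsymmu]
    exact Φ.left_inv hy
  have hτc : ContDiffAt ℝ ∞ τ u := by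
    have h1 : ContMDiffAt 𝓘(ℝ, E) 𝓘(ℝ, E) ∞ Φ.symm ((extChartAt 𝓘(ℝ, E) p).symm u) := by
      rw [hsymmu]
      exact Φ.contMDiffOn_invFun.contMDiffAt (Φ.open_target.mem_nhds hpT)
    exact (h1.comp u (contMDiffAt_extChartAt_symm hpt)).contDiffAt
  have hθc : ContDiffAt ℝ ∞ θ y := contDiffAt_extChartAt_comp (hΦ y hy) hps
  have htgt : ∀ᶠ v in 𝓝 u, v ∈ (extChartAt 𝓘(ℝ, E) p).target :=
    (isOpen_extChartAt_target p).mem_nhds hpt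
  have hΦτ : ∀ᶠ v in 𝓝 u, Φ (τ v) = (extChartAt 𝓘(ℝ, E) p).symm v := by
    have h1 : ∀ᶠ v in 𝓝 u, (extChartAt 𝓘(ℝ, E) p).symm v ∈ Φ.target :=
      (contMDiffAt_extChartAt_symm hpt).continuousAt
        (by rw [hsymmu]; exact Φ.open_target.mem_nhds hpT)
    exact h1.mono fun v hv ↦ Φ.right_inv hv
  have hθτ : ∀ᶠ v in 𝓝 u, θ (τ v) = v := by
    filter_upwards [hΦτ, htgt] with v hv hv'
    simp only [hθ, hv]
    exact (extChartAt 𝓘(ℝ, E) p).right_inv hv'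
  have hτtend : Filter.Tendsto τ (𝓝 u) (𝓝 y) := by
    have := hτc.continuousAt.tendsto
    rwa [hτu] at this
  have hFc : coordTensor p F =ᶠ[𝓝 u] flatPull τ (pullTensor Φ F) := by
    filter_upwards [hΦτ.eventually_nhds, hτtend.eventually hsrc,
      (hτc.of_le (m := 1) (by norm_cast)).eventually (by simp)] with v hv hv' hv''
    rw [coordTensor_eq_pullTensor, ← pullTensor_comp (hΦd _ hv') (hv''.differentiableAt (by simp))]
    exact (pullTensor_congr hv).symm
  have hXc : ∀ᶠ w in 𝓝 y, coordVF p X (θ w) = fderiv ℝ θ w (X' w) := by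
    filter_upwards [hsrc, hchart, hX] with w h1 h2 h3
    exact coordVF_apply_eq (hΦd w h1) h2 h3
  have hXc' : coordVF p X =ᶠ[𝓝 u] fun v ↦ fderiv ℝ θ (τ v) (X' (τ v)) := by
    filter_upwards [hτtend.eventually hXc, hθτ] with v h1 h2
    rw [← h1, h2]
  have hτd : DifferentiableAt ℝ τ u := hτc.differentiableAt (by simp)
  have hX'u : DifferentiableAt ℝ X' (τ u) := by rwa [hτu]
  have hFu : DifferentiableAt ℝ (pullTensor Φ F) (τ u) := by rwa [hτu]
  have hθ2 : ContDiffAt ℝ 2 θ y := hθc.of_le (by norm_cast)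
  have hθu : DifferentiableAt ℝ (fderiv ℝ θ) (τ u) := by
    rw [hτu]
    exact differentiableAt_fderiv hθ2
  have hXd : DifferentiableAt ℝ (coordVF p X) u := by
    have h1 : DifferentiableAt ℝ (fun v ↦ fderiv ℝ θ (τ v)) u :=
      DifferentiableAt.comp (g := fderiv ℝ θ) u hθu hτd
    have h2 : DifferentiableAt ℝ (fun v ↦ X' (τ v)) u := hX'u.comp u hτd
    exact (h1.clm_apply h2).congr_of_eventuallyEq hXc'
  have hFd : DifferentiableAt ℝ (coordTensor p F) u :=
    (differentiableAt_flatPull (hτc.of_le (by norm_cast)) hFu).congr_of_eventuallyEq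
      hFc
  have hpull : pullTensor Φ F =ᶠ[𝓝 y] flatPull θ (coordTensor p F) := by
    filter_upwards [hsrc, hchart] with w h1 h2
    exact pullTensor_eq_flatPull (hΦd w h1) h2
  rw [flatLie_congr hpull, flatLie_flatPull hθ2 hFd hXd hX' (hXc.mono fun w hw ↦ hw.symm)]
  have hmd : modelDeriv Φ y = fderiv ℝ θ y := by
    rw [modelDeriv_eq_comp (x₀ := p) (hΦd y hy) hps]
    have := modelDeriv_extChartAt_symm_self (E := E) p
    rw [this, ContinuousLinearMap.id_comp]
  ext a b
  rw [pullTensor_apply, hmd, lieDeriv_eq, chartDeriv_eq_id]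
  rfl

/-! ### Nondegeneracy, Christoffel symbols and the deformation tensor. -/

section Metric

theorem isInvertible_of_injective [FiniteDimensional ℝ E] {G : E →L[ℝ] E →L[ℝ] ℝ}
    (hG : Function.Injective G) : G.IsInvertible := by
  have hrank : Module.finrank ℝ E = Module.finrank ℝ (E →L[ℝ] ℝ) := by
    rw [← (LinearMap.toContinuousLinearMap (𝕜 := ℝ) (E := E) (F' := ℝ)).finrank_eq]
    exact (Subspace.dual_finrank_eq (K := ℝ) (V := E)).symm
  refine ⟨(LinearEquiv.ofInjectiveOfFinrankEq
    G.toLinearMap hG hrank).toContinuousLinearEquiv, ?_⟩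
  ext v w
  rfl

theorem injective_of_eta {G : E →L[ℝ] E →L[ℝ] ℝ} (e : Module.Basis (Fin 4) ℝ E)
    (he : ∀ a b, G (e a) (e b) = eta a b) : Function.Injective G := by
  rw [injective_iff_map_eq_zero]
  intro v hv
  have hcoef : ∀ b, e.repr v b = 0 := by
    intro b
    have h1 : G v (e b) = e.repr v b * eta b b := by
      conv_lhs => rw [← e.sum_repr v]
      simp only [map_sum, map_smul, sum_apply, smul_apply, smul_eq_mul, he]
      rw [Finset.sum_eq_single b]
      · intro a _ hab
        simp [eta, hab]
      · simp
    rw [hv, zero_apply] at h1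
    refine (mul_eq_zero.1 h1.symm).resolve_right ?_
    simp only [eta, if_true]
    split_ifs <;> norm_num
  exact e.repr.map_eq_zero_iff.1 (Finsupp.ext hcoef)

theorem injective_metric (g : LorentzMetric E M) (x : M) :
    Function.Injective (g.val x : E →L[ℝ] E →L[ℝ] ℝ) := by
  obtain ⟨e, he⟩ := g.signature x
  exact injective_of_eta (E := E) e he

variable (g : LorentzMetric E M)

theorem isInvertible_coordTensor [FiniteDimensional ℝ E] {x₀ : M} {u : E}
    (hu : u ∈ (extChartAt 𝓘(ℝ, E) x₀).target) :
    (coordTensor x₀ g.val u).IsInvertible := by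
  have hA := isInvertible_modelDeriv_extChartAt_symm hu
  refine isInvertible_of_injective ?_
  rw [injective_iff_map_eq_zero]
  intro v hv
  apply hA.injective
  rw [map_zero]
  refine (injective_iff_map_eq_zero _).1 (injective_metric g ((extChartAt 𝓘(ℝ, E) x₀).symm u)) _ ?_
  refine ContinuousLinearMap.ext fun w ↦ ?_
  obtain ⟨w, rfl⟩ := hA.surjective w
  exact congrArg (fun L ↦ L w) hv

theorem pullTensor_symm (f : E → M) (y v w : E) :
    pullTensor f g.val y v w = pullTensor f g.val y w v :=
  (pullTensor_apply _ _ _ _ _).trans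
    ((g.symm _ _ _).trans (pullTensor_apply f g.val y w v).symm)

theorem coordTensor_symm (x₀ : M) (u v w : E) :
    coordTensor x₀ g.val u v w = coordTensor x₀ g.val u w v :=
  pullTensor_symm g _ u v w

theorem apply_half_inverse {G : E →L[ℝ] E →L[ℝ] ℝ} (hG : G.IsInvertible)
    (D : E →L[ℝ] E →L[ℝ] E →L[ℝ] ℝ) (v w z : E) :
    G (((1 / 2 : ℝ) • (G.inverse ∘L (D.flip w + D w - (D.flip w).flip))) v) z =
      (1 / 2) * (D v w z + D w v z - D z w v) := by
  rw [smul_apply, map_smul, ContinuousLinearMap.comp_apply, hG.self_apply_inverse]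
  rfl

/-- Koszul formula: lowering the index cancels the inverse metric in `christoffel`, so later
arguments never meet that inverse. -/
theorem coordTensor_christoffel [FiniteDimensional ℝ E] {x₀ : M} {u : E}
    (hu : u ∈ (extChartAt 𝓘(ℝ, E) x₀).target) (v w z : E) :
    coordTensor x₀ g.val u (christoffel g x₀ u w v) z =
      (1 / 2) * (fderiv ℝ (coordTensor x₀ g.val) u v w z + fderiv ℝ (coordTensor x₀ g.val) u w v z
        - fderiv ℝ (coordTensor x₀ g.val) u z w v) :=
  apply_half_inverse (isInvertible_coordTensor g hu) _ v w z

theorem fderiv_coordTensor_symm [FiniteDimensional ℝ E] {x₀ : M} {u : E}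
    (hu : u ∈ (extChartAt 𝓘(ℝ, E) x₀).target) (z v w : E) :
    fderiv ℝ (coordTensor x₀ g.val) u z v w = fderiv ℝ (coordTensor x₀ g.val) u z w v := by
  have hd := (contDiffAt_coordTensor g hu).differentiableAt (by simp)
  rw [fderiv_form_apply hd, fderiv_form_apply hd]
  simp only [coordTensor_symm g x₀ _ v w]

theorem coordTensor_self (p : M) (a b : E) : (g.val p : E →L[ℝ] E →L[ℝ] ℝ) a b =
    coordTensor p g.val (extChartAt 𝓘(ℝ, E) p p) a b := by
  have h1 := pullTensor_apply (extChartAt 𝓘(ℝ, E) p).symm g.val (extChartAt 𝓘(ℝ, E) p p) a b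
  rw [coordTensor_eq_pullTensor, h1, modelDeriv_extChartAt_symm_self]
  have h2 : ∀ q : M, q = p → (g.val p : E →L[ℝ] E →L[ℝ] ℝ) a b = g.val q (a : E) (b : E) := by
    rintro _ rfl
    rfl
  exact h2 _ (extChartAt_to_inv p)

/-- The deformation tensor of a vector field is the Lie derivative of the metric. -/
theorem deformation_eq_lieDeriv [FiniteDimensional ℝ E] (X : VField E M) :
    deformation g X = lieDeriv X g.val := by
  funext p
  have hu : extChartAt 𝓘(ℝ, E) p p ∈ (extChartAt 𝓘(ℝ, E) p).target := mem_extChartAt_target p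
  have hG := coordTensor_self g p
  have hcov : covDeriv g X p = fderiv ℝ (coordVF p X) (extChartAt 𝓘(ℝ, E) p p) +
      christoffel g p (extChartAt 𝓘(ℝ, E) p p) (coordVF p X (extChartAt 𝓘(ℝ, E) p p)) := by
    simp only [covDeriv, chartDeriv_eq_id, ContinuousLinearMap.inverse_id]
    rfl
  have key : ∀ a b : E, (deformation g X p : E →L[ℝ] E →L[ℝ] ℝ) a b =
      flatLie (coordVF p X) (coordTensor p g.val) (extChartAt 𝓘(ℝ, E) p p) a b := by
    intro a b
    have h1 : (deformation g X p : E →L[ℝ] E →L[ℝ] ℝ) a b =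
      (g.val p : E →L[ℝ] E →L[ℝ] ℝ) (covDeriv g X p a) b +
        (g.val p : E →L[ℝ] E →L[ℝ] ℝ) (covDeriv g X p b) a := rfl
    -- By the Koszul formula the two Christoffel terms add up to the derivative of the metric along
    -- `X`; the remaining derivatives cancel in pairs.
    rw [h1, hG, hG, hcov, add_apply, add_apply, map_add, map_add, add_apply, add_apply,
      coordTensor_christoffel g hu, coordTensor_christoffel g hu, flatLie_apply,
      fderiv_coordTensor_symm g hu _ a b,
      coordTensor_symm g p _ a (fderiv ℝ (coordVF p X) (extChartAt 𝓘(ℝ, E) p p) b)]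
    ring
  refine ContinuousLinearMap.ext fun a ↦ ContinuousLinearMap.ext fun b ↦ ?_
  rw [lieDeriv_eq, chartDeriv_eq_id]
  exact key a b

end Metric

end Charts

/-! ### Uniqueness and rescaling of geodesics; values of the exponential map. -/

section Geodesics

variable {E : Type*} [NormedAddCommGroup E] [NormedSpace ℝ E]
  {M : Type*} [TopologicalSpace M] [ChartedSpace E M] [IsManifold 𝓘(ℝ, E) ∞ M]
  (g : LorentzMetric E M)

/-- The vector field on phase space whose integral curves are the geodesics in the chart
around `x₀`. -/
def geodesicField (x₀ : M) (q : E × E) : E × E := (q.2, -christoffel g x₀ q.1 q.2 q.2)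

/-- The phase space curve, in the chart around `x₀`, of a curve in `M`. -/
def phaseCurve (x₀ : M) (c : ℝ → M) (t : ℝ) : E × E :=
  (extChartAt 𝓘(ℝ, E) x₀ (c t), deriv (fun r ↦ extChartAt 𝓘(ℝ, E) x₀ (c r)) t)

/-- Near `t`, the curve `c` stays in the chart around `x₀` and solves the geodesic equation. -/
def SolvesGeodesicAt (x₀ : M) (c : ℝ → M) (t : ℝ) : Prop :=
  ∀ᶠ r in 𝓝 t, c r ∈ (chartAt E x₀).source ∧
    HasDerivAt (phaseCurve x₀ c) (geodesicField g x₀ (phaseCurve x₀ c r)) r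

variable {g}

theorem christoffel_smul (x₀ : M) (u v : E) (t : ℝ) :
    christoffel g x₀ u (t • v) (t • v) = (t * t) • christoffel g x₀ u v v := by
  have h : christoffel g x₀ u (t • v) = t • christoffel g x₀ u v := by
    simp only [christoffel, map_smul, ← smul_add, ← smul_sub, ContinuousLinearMap.comp_smul,
      smul_comm t, ContinuousLinearMap.flip_smul]
  rw [h, map_smul, smul_apply, smul_smul]

theorem contDiffAt_geodesicField [FiniteDimensional ℝ E] {x₀ : M} {q : E × E}
    (hq : q.1 ∈ (extChartAt 𝓘(ℝ, E) x₀).target) :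
    ContDiffAt ℝ ∞ (geodesicField g x₀) q := by
  have hG := contDiffAt_coordTensor g hq
  have hD := (hG.fderiv_right (m := ∞) (by simp)).comp q contDiffAt_fst
  have hinv : ContDiffAt ℝ ∞ (fun q : E × E ↦ (coordTensor x₀ g.val q.1).inverse) q := by
    obtain ⟨A, hA⟩ := isInvertible_coordTensor g hq
    have := contDiffAt_map_inverse (𝕜 := ℝ) (n := ∞) A
    rw [hA] at this
    exact ContDiffAt.comp (g := ContinuousLinearMap.inverse) q this
      (hG.comp q contDiffAt_fst)
  have h2 : ContDiffAt ℝ ∞ (fun q : E × E ↦ q.2) q := contDiffAt_snd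
  have hDf := (ContDiffAt.flip hD).clm_apply h2
  have hΓ := ((contDiffAt_const (c := (1 / 2 : ℝ))).smul (hinv.clm_comp
    ((hDf.add (hD.clm_apply h2)).sub (ContDiffAt.flip hDf)))).clm_apply h2
  exact h2.prodMk hΓ.neg

theorem SolvesGeodesicAt.continuousAt {x₀ : M} {c : ℝ → M} {t : ℝ}
    (h : SolvesGeodesicAt g x₀ c t) : ContinuousAt c t := by
  have h1 : ContinuousAt (fun r ↦ extChartAt 𝓘(ℝ, E) x₀ (c r)) t :=
    (h.self_of_nhds.2.continuousAt).fst
  have hs : c t ∈ (extChartAt 𝓘(ℝ, E) x₀).source := by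
    rw [extChartAt_source]; exact h.self_of_nhds.1
  have h2 := (continuousAt_extChartAt_symm'' (I := 𝓘(ℝ, E))
    ((extChartAt 𝓘(ℝ, E) x₀).map_source hs)).comp (f := fun r ↦ extChartAt 𝓘(ℝ, E) x₀ (c r)) h1
  refine h2.congr ?_
  filter_upwards [h] with r hr
  exact (extChartAt 𝓘(ℝ, E) x₀).left_inv (by rw [extChartAt_source]; exact hr.1)

/-- The phase space field is smooth, hence locally Lipschitz, so ODE uniqueness applies to position
and velocity together. -/
theorem SolvesGeodesicAt.eventuallyEq [FiniteDimensional ℝ E] {x₀ : M} {c₁ c₂ : ℝ → M} {t : ℝ}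
    (h₁ : SolvesGeodesicAt g x₀ c₁ t) (h₂ : SolvesGeodesicAt g x₀ c₂ t)
    (h : phaseCurve (E := E) x₀ c₁ t = phaseCurve x₀ c₂ t) : c₁ =ᶠ[𝓝 t] c₂ := by
  have hs : c₁ t ∈ (extChartAt 𝓘(ℝ, E) x₀).source := by
    rw [extChartAt_source]; exact h₁.self_of_nhds.1
  have hq : (phaseCurve x₀ c₁ t).1 ∈ (extChartAt 𝓘(ℝ, E) x₀).target :=
    (extChartAt 𝓘(ℝ, E) x₀).map_source hs
  obtain ⟨K, U, hU, hK⟩ := ((contDiffAt_geodesicField (g := g) hq).of_le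
    (m := 1) (by norm_cast)).exists_lipschitzOnWith
  have key : ∀ c : ℝ → M, SolvesGeodesicAt g x₀ c t →
      phaseCurve (E := E) x₀ c₁ t = phaseCurve x₀ c t → ∀ᶠ r in 𝓝 t,
      HasDerivAt (phaseCurve x₀ c) (geodesicField g x₀ (phaseCurve x₀ c r)) r ∧
        phaseCurve x₀ c r ∈ U := by
    intro c hc hc'
    have hcont := hc.self_of_nhds.2.continuousAt
    filter_upwards [hc, hcont (by rw [← hc']; exact hU)] with r h1 h2
    exact ⟨h1.2, h2⟩
  have huniq := ODE_solution_unique_of_eventually (v := fun _ ↦ geodesicField g x₀)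
    (s := fun _ ↦ U) (K := K) (Filter.Eventually.of_forall fun _ ↦ hK) (key c₁ h₁ rfl)
    (key c₂ h₂ h) h
  filter_upwards [huniq, h₁, h₂] with r hr h1 h2
  refine (extChartAt 𝓘(ℝ, E) x₀).injOn ?_ ?_ (congrArg Prod.fst hr)
  · rw [extChartAt_source]; exact h1.1
  · rw [extChartAt_source]; exact h2.1

/-- Two geodesics that agree near one point of an interval agree on the interval. -/
theorem geodesic_unique [FiniteDimensional ℝ E] [T2Space M] {c₁ c₂ : ℝ → M} {a b t₀ : ℝ}
    (ht₀ : t₀ ∈ Set.Icc a b) (h₀ : c₁ =ᶠ[𝓝 t₀] c₂)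
    (hc₁ : ∀ t ∈ Set.Icc a b, ContinuousAt c₁ t) (hc₂ : ∀ t ∈ Set.Icc a b, ContinuousAt c₂ t)
    (h : ∀ t ∈ Set.Icc a b, c₁ t = c₂ t →
      ∃ x₀, SolvesGeodesicAt g x₀ c₁ t ∧ SolvesGeodesicAt g x₀ c₂ t) :
    ∀ t ∈ Set.Icc a b, c₁ =ᶠ[𝓝 t] c₂ := by
  have hsub : Set.Icc a b ⊆ {t | c₁ =ᶠ[𝓝 t] c₂} := by
    refine isPreconnected_Icc.subset_of_closure_inter_subset isOpen_setOfPred_eventually_nhds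
      ⟨t₀, ht₀, h₀⟩ ?_
    -- Closedness of the agreement set within the interval: at a limit point the positions agree
    -- because `M` is Hausdorff, the velocities by continuity in a chart, and local uniqueness takes
    -- over.
    rintro t ⟨hcl, ht⟩
    have hfreq : ∃ᶠ r in 𝓝 t, c₁ =ᶠ[𝓝 r] c₂ := mem_closure_iff_frequently.1 hcl
    have heq : c₁ t = c₂ t := tendsto_nhds_unique_of_frequently_eq (hc₁ t ht) (hc₂ t ht)
      (hfreq.mono fun r hr ↦ hr.self_of_nhds)
    obtain ⟨x₀, h1, h2⟩ := h t ht heq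
    refine h1.eventuallyEq h2 ?_
    refine tendsto_nhds_unique_of_frequently_eq h1.self_of_nhds.2.continuousAt
      h2.self_of_nhds.2.continuousAt (hfreq.mono fun r hr ↦ ?_)
    have hr' : (fun r ↦ extChartAt 𝓘(ℝ, E) x₀ (c₁ r)) =ᶠ[𝓝 r]
        fun r ↦ extChartAt 𝓘(ℝ, E) x₀ (c₂ r) := hr.fun_comp _
    exact Prod.ext hr'.self_of_nhds hr'.deriv_eq
  exact fun t ht ↦ hsub ht

theorem IsGeodesicOn.contMDiffAt {c : ℝ → M} {s : Set ℝ} (hs : IsOpen s)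
    (hc : IsGeodesicOn g c s) {t : ℝ} (ht : t ∈ s) : ContMDiffAt 𝓘(ℝ, ℝ) 𝓘(ℝ, E) ∞ c t :=
  hc.1.contMDiffAt (hs.mem_nhds ht)

theorem contDiffAt_extChartAt_curve {c : ℝ → M} {t : ℝ} {x₀ : M}
    (hc : ContMDiffAt 𝓘(ℝ, ℝ) 𝓘(ℝ, E) ∞ c t) (hx : c t ∈ (chartAt E x₀).source) :
    ContDiffAt ℝ ∞ (fun r ↦ extChartAt 𝓘(ℝ, E) x₀ (c r)) t :=
  ((contMDiffAt_extChartAt' (I := 𝓘(ℝ, E)) hx).comp t hc).contDiffAt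

theorem IsGeodesicOn.solvesGeodesicAt {c : ℝ → M} {s : Set ℝ} (hs : IsOpen s)
    (hc : IsGeodesicOn g c s) {t : ℝ} (ht : t ∈ s) {x₀ : M} (hx : c t ∈ (chartAt E x₀).source) :
    SolvesGeodesicAt g x₀ c t := by
  filter_upwards [hs.mem_nhds ht, (hc.contMDiffAt hs ht).continuousAt
    ((chartAt E x₀).open_source.mem_nhds hx)] with r hr hrx
  refine ⟨hrx, ?_⟩
  have hγ := contDiffAt_extChartAt_curve (hc.contMDiffAt hs hr) hrx
  have h1 : HasDerivAt (fun r ↦ extChartAt 𝓘(ℝ, E) x₀ (c r)) _ r :=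
    (hγ.differentiableAt (by simp)).hasDerivAt
  have h2 : HasDerivAt (deriv fun r ↦ extChartAt 𝓘(ℝ, E) x₀ (c r))
      (deriv (deriv fun r ↦ extChartAt 𝓘(ℝ, E) x₀ (c r)) r) r := by
    have : ContDiffAt ℝ ∞ (deriv fun r ↦ extChartAt 𝓘(ℝ, E) x₀ (c r)) r := by
      have h3 := (hγ.fderiv_right (m := ∞) (by simp)).clm_apply
        (contDiffAt_const (c := (1 : ℝ)))
      exact h3
    exact (this.differentiableAt (by simp)).hasDerivAt
  have h3 := hc.2 r hr x₀ hrx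
  have h4 := h1.prodMk h2
  rw [eq_neg_of_add_eq_zero_left h3] at h4
  exact h4

/-- The initial velocity of a curve, read in the chart around its starting point. -/
theorem deriv_of_tangentMap_eq {O : M} {w : TangentSpace 𝓘(ℝ, E) O} {c : ℝ → M} {t : ℝ}
    (hc : MDifferentiableAt 𝓘(ℝ, ℝ) 𝓘(ℝ, E) c t)
    (h : tangentMap 𝓘(ℝ, ℝ) 𝓘(ℝ, E) c ⟨t, (1 : ℝ)⟩ = ⟨O, w⟩) :
    c t = O ∧ deriv (fun r ↦ extChartAt 𝓘(ℝ, E) O (c r)) t = w := by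
  have h1 : c t = O := congrArg Bundle.TotalSpace.proj h
  refine ⟨h1, ?_⟩
  have h2 := congrArg (fun q : TangentBundle 𝓘(ℝ, E) M ↦
    (mfderiv 𝓘(ℝ, E) 𝓘(ℝ, E) (extChartAt 𝓘(ℝ, E) O) q.1 q.2 : E)) h
  have hx : c t ∈ (chartAt E O).source := by rw [h1]; exact mem_chart_source E O
  have h3 := mfderiv_comp t (mdifferentiableAt_extChartAt (I := 𝓘(ℝ, E)) hx) hc
  have h4 : deriv (fun r ↦ extChartAt 𝓘(ℝ, E) O (c r)) t =
      mfderiv 𝓘(ℝ, ℝ) 𝓘(ℝ, E) (extChartAt 𝓘(ℝ, E) O ∘ c) t (1 : ℝ) := by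
    rw [mfderiv_eq_fderiv]
    rfl
  have h5 : (mfderiv 𝓘(ℝ, E) 𝓘(ℝ, E) (extChartAt 𝓘(ℝ, E) O) O w : E) = w := by
    have := chartDeriv_eq_id (E := E) O
    exact congrArg (fun A : E →L[ℝ] E ↦ A w) this
  rw [h4, h3]
  exact h2.trans h5

theorem IsGeodesicFrom.start {O : M} {w : TangentSpace 𝓘(ℝ, E) O} {c : ℝ → M}
    (hc : IsGeodesicFrom g O w c) :
    c 0 = O ∧ deriv (fun r ↦ extChartAt 𝓘(ℝ, E) O (c r)) 0 = w := by
  obtain ⟨⟨s, hs, hIs, hg⟩, h0⟩ := hc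
  exact deriv_of_tangentMap_eq
    ((hg.contMDiffAt hs (hIs (by simp))).mdifferentiableAt (by simp)) h0

/-- Makes the value of `expMap` independent of the geodesic picked by choice. -/
theorem IsGeodesicFrom.unique [FiniteDimensional ℝ E] [T2Space M] {O : M}
    {w : TangentSpace 𝓘(ℝ, E) O} {c₁ c₂ : ℝ → M}
    (h₁ : IsGeodesicFrom g O w c₁) (h₂ : IsGeodesicFrom g O w c₂) : c₁ 1 = c₂ 1 := by
  obtain ⟨hO₁, hd₁⟩ := h₁.start
  obtain ⟨hO₂, hd₂⟩ := h₂.start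
  obtain ⟨⟨s₁, hs₁, hI₁, hg₁⟩, -⟩ := h₁
  obtain ⟨⟨s₂, hs₂, hI₂, hg₂⟩, -⟩ := h₂
  have h0 : (0 : ℝ) ∈ Set.Icc (0 : ℝ) 1 := by simp
  have hx₁ : c₁ 0 ∈ (chartAt E O).source := by rw [hO₁]; exact mem_chart_source E O
  have hx₂ : c₂ 0 ∈ (chartAt E O).source := by rw [hO₂]; exact mem_chart_source E O
  have hev : c₁ =ᶠ[𝓝 0] c₂ := by
    refine (hg₁.solvesGeodesicAt hs₁ (hI₁ h0) hx₁).eventuallyEq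
      (hg₂.solvesGeodesicAt hs₂ (hI₂ h0) hx₂) ?_
    simp only [phaseCurve, hO₁, hO₂, hd₁, hd₂]
  refine (geodesic_unique (g := g) h0 hev
    (fun t ht ↦ (hg₁.contMDiffAt hs₁ (hI₁ ht)).continuousAt)
    (fun t ht ↦ (hg₂.contMDiffAt hs₂ (hI₂ ht)).continuousAt) ?_ 1 (by simp)).self_of_nhds
  intro t ht heq
  exact ⟨c₁ t, hg₁.solvesGeodesicAt hs₁ (hI₁ ht) (mem_chart_source E _),
    hg₂.solvesGeodesicAt hs₂ (hI₂ ht) (by rw [← heq]; exact mem_chart_source E _)⟩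

theorem IsGeodesicFrom.expMap_eq [FiniteDimensional ℝ E] [T2Space M] {O : M} {w : E} {c : ℝ → M}
    (hc : IsGeodesicFrom g O w c) : expMap g O w = c 1 := by
  have hw : w ∈ expDomain g O := ⟨c, hc⟩
  rw [expMap, dif_pos hw]
  exact (Classical.choose_spec hw).unique hc

/-- The acceleration and the quadratic Christoffel term both scale by `t²`. -/
theorem IsGeodesicOn.comp_mul_left {c : ℝ → M} {s : Set ℝ}
    (hc : IsGeodesicOn g c s) (t : ℝ) :
    IsGeodesicOn g (fun r ↦ c (t * r)) ((fun r ↦ t * r) ⁻¹' s) := by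
  have hm : ContMDiff 𝓘(ℝ, ℝ) 𝓘(ℝ, ℝ) ∞ (fun r : ℝ ↦ t * r) :=
    (contDiff_const.mul contDiff_id).contMDiff
  refine ⟨hc.1.comp hm.contMDiffOn subset_rfl, ?_⟩
  intro r hr x₀ hx
  have h1 := hc.2 (t * r) hr x₀ hx
  dsimp only at h1 ⊢
  set γ : ℝ → E := fun r ↦ extChartAt 𝓘(ℝ, E) x₀ (c r) with hγ
  have h2 : deriv (fun r ↦ γ (t * r)) = fun r ↦ t • deriv γ (t * r) := by
    funext r
    exact deriv_comp_mul_left t γ r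
  have h3 : deriv (fun r ↦ t • deriv γ (t * r)) r = (t * t) • deriv (deriv γ) (t * r) := by
    rw [deriv_fun_const_smul_field, deriv_comp_mul_left t (deriv γ) r, smul_smul]
  change deriv (deriv fun r ↦ γ (t * r)) r + christoffel g x₀ (γ (t * r))
    (deriv (fun r ↦ γ (t * r)) r) (deriv (fun r ↦ γ (t * r)) r) = 0
  rw [h2, h3]
  dsimp only
  rw [christoffel_smul, ← smul_add, h1, smul_zero]

theorem IsGeodesicOn.isGeodesicFrom_smul {O : M} {w : E} {c : ℝ → M} {s : Set ℝ} (hs : IsOpen s)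
    (hc : IsGeodesicOn g c s) {t : ℝ} (ht : 0 ≤ t) (hts : Set.Icc 0 t ⊆ s)
    (h0 : tangentMap 𝓘(ℝ, ℝ) 𝓘(ℝ, E) c ⟨0, (1 : ℝ)⟩ = ⟨O, w⟩) :
    IsGeodesicFrom g O (t • w : E) (fun r ↦ c (t * r)) := by
  refine ⟨⟨_, hs.preimage (continuous_const.mul continuous_id), ?_, hc.comp_mul_left t⟩, ?_⟩
  · intro r hr
    exact hts ⟨mul_nonneg ht hr.1, mul_le_of_le_one_right ht hr.2⟩
  · have hcd : MDifferentiableAt 𝓘(ℝ, ℝ) 𝓘(ℝ, E) c (t * 0) := by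
      rw [mul_zero]
      exact (hc.contMDiffAt hs (hts ⟨le_rfl, ht⟩)).mdifferentiableAt (by simp)
    have hm : HasDerivAt (fun r : ℝ ↦ t * r) t 0 := by
      simpa using (hasDerivAt_id (0 : ℝ)).const_mul t
    have h1 := tangentMap_comp_at (⟨0, (1 : ℝ)⟩ : TangentBundle 𝓘(ℝ, ℝ) ℝ) hcd
      hm.differentiableAt.mdifferentiableAt
    have h2 : tangentMap 𝓘(ℝ, ℝ) 𝓘(ℝ, ℝ) (fun r : ℝ ↦ t * r) ⟨0, (1 : ℝ)⟩ =
        (⟨0, t⟩ : TangentBundle 𝓘(ℝ, ℝ) ℝ) := by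
      have h4 : ∀ x v : ℝ, x = 0 → v = t →
          (⟨x, v⟩ : TangentBundle 𝓘(ℝ, ℝ) ℝ) = ⟨0, t⟩ := by
        rintro _ _ rfl rfl
        rfl
      refine h4 _ _ (mul_zero t) ?_
      change (mfderiv 𝓘(ℝ, ℝ) 𝓘(ℝ, ℝ) (fun r : ℝ ↦ t * r) 0 : ℝ →L[ℝ] ℝ) (1 : ℝ) = t
      rw [mfderiv_eq_fderiv]
      exact hm.deriv
    have h3 : tangentMap 𝓘(ℝ, ℝ) 𝓘(ℝ, E) c ⟨0, t⟩ = (⟨O, t • w⟩ : TangentBundle 𝓘(ℝ, E) M) := by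
      have h4 := congrArg (fun q : TangentBundle 𝓘(ℝ, E) M ↦
        (⟨q.1, t • q.2⟩ : TangentBundle 𝓘(ℝ, E) M)) h0
      refine Eq.trans ?_ h4
      have h5 : ∀ A : ℝ →L[ℝ] E, A t = t • A 1 := fun A ↦ by
        rw [← map_smul, smul_eq_mul, mul_one]
      exact congrArg (fun v : E ↦ (⟨c 0, v⟩ : TangentBundle 𝓘(ℝ, E) M))
        (h5 (mfderiv 𝓘(ℝ, ℝ) 𝓘(ℝ, E) c 0))
    rw [h2, h3] at h1
    exact h1

/-- By rescaling, time `t` at velocity `w` is time `1` at velocity `t • w`; this is what turns rays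
into geodesics. -/
theorem IsGeodesicOn.expMap_smul [FiniteDimensional ℝ E] [T2Space M] {O : M} {w : E} {c : ℝ → M}
    {s : Set ℝ} (hs : IsOpen s)
    (hc : IsGeodesicOn g c s) {t : ℝ} (ht : 0 ≤ t) (hts : Set.Icc 0 t ⊆ s)
    (h0 : tangentMap 𝓘(ℝ, ℝ) 𝓘(ℝ, E) c ⟨0, (1 : ℝ)⟩ = ⟨O, w⟩) :
    expMap g O (t • w) = c t := by
  have := (hc.isGeodesicFrom_smul hs ht hts h0).expMap_eq
  rwa [mul_one] at this

end Geodesics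

/-! ### Lipschitz bound for the exponential map near the origin. -/

section Geodesics

variable {E : Type*} [NormedAddCommGroup E] [NormedSpace ℝ E] [FiniteDimensional ℝ E]
  {M : Type*} [TopologicalSpace M] [ChartedSpace E M] [IsManifold 𝓘(ℝ, E) ∞ M]
  (g : LorentzMetric E M)

/-- The geodesic flow in the chart around `O`, for small times and small initial velocities, is
Lipschitz continuous in the initial velocity. -/
theorem exists_geodesic_flow (O : M) :
    ∃ ε > (0 : ℝ), ∃ δ > (0 : ℝ), ∃ L : NNReal, ∃ α : E → ℝ → E × E,
      (∀ w, ‖w‖ ≤ δ → α w 0 = (extChartAt 𝓘(ℝ, E) O O, w) ∧ ∀ t ∈ Set.Ioo (-ε) ε,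
        HasDerivAt (α w) (geodesicField g O (α w t)) t ∧
          (α w t).1 ∈ (extChartAt 𝓘(ℝ, E) O).target) ∧
      ∀ t ∈ Set.Ioo (-ε) ε, ∀ w₁ w₂, ‖w₁‖ ≤ δ → ‖w₂‖ ≤ δ →
        dist (α w₁ t) (α w₂ t) ≤ L * dist w₁ w₂ := by
  have : CompleteSpace E := FiniteDimensional.complete ℝ E
  set u₀ : E := extChartAt 𝓘(ℝ, E) O O with hu₀
  have hu₀t : u₀ ∈ (extChartAt 𝓘(ℝ, E) O).target := mem_extChartAt_target O
  -- Picard–Lindelöf around zero velocity gives one time interval and one Lipschitz constant for all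
  -- small initial velocities.
  have hf : ContDiffAt ℝ 1 (geodesicField g O) (u₀, 0) :=
    (contDiffAt_geodesicField (g := g) (q := (u₀, 0)) hu₀t).of_le (by norm_cast)
  obtain ⟨ε₀, hε₀, a, r, L₀, K, hr, hP⟩ := IsPicardLindelof.of_contDiffAt_one hf
  obtain ⟨α, hα, L, hL⟩ := (hP 0).exists_forall_mem_closedBall_eq_hasDerivWithinAt_lipschitzOnWith
  obtain ⟨η, hη, hηt⟩ := Metric.isOpen_iff.1 (isOpen_extChartAt_target (I := 𝓘(ℝ, E)) O) u₀ hu₀t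
  have hball : ∀ w : E, ‖w‖ ≤ r → (u₀, w) ∈ Metric.closedBall ((u₀, 0) : E × E) r := by
    intro w hw
    rw [Metric.mem_closedBall, Prod.dist_eq]
    simpa using hw
  have h0r : ‖(0 : E)‖ ≤ r := by simp
  have hderiv : ∀ w : E, ‖w‖ ≤ r → ∀ t ∈ Set.Ioo (-ε₀) ε₀,
      HasDerivAt (α (u₀, w)) (geodesicField g O (α (u₀, w) t)) t := by
    intro w hw t ht
    exact ((hα _ (hball w hw)).2 t ⟨by linarith [ht.1], by linarith [ht.2]⟩).hasDerivAt
      (Icc_mem_nhds (by linarith [ht.1]) (by linarith [ht.2]))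
  have hcont : ContinuousAt (α (u₀, 0)) 0 :=
    (hderiv 0 h0r 0 ⟨by linarith, hε₀⟩).continuousAt
  have hα0 : α (u₀, 0) 0 = (u₀, 0) := (hα _ (hball 0 h0r)).1
  obtain ⟨ε₁, hε₁, hε₁'⟩ := Metric.continuousAt_iff.1 hcont (η / 2) (half_pos hη)
  rw [hα0] at hε₁'
  have hrpos : (0 : ℝ) < r := hr
  -- `ε₁` keeps the solution of zero velocity within `η / 2` of `u₀`; the bound `η / (2 * (L + 1))`
  -- keeps the other solutions within `η / 2` of it. All thus stay in the ball of radius `η`, inside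
  -- the chart.
  refine ⟨min ε₀ ε₁, lt_min hε₀ hε₁, min r (η / (2 * (L + 1))), lt_min hrpos (by positivity),
    L, fun w ↦ α (u₀, w), ?_, ?_⟩
  · intro w hw
    have hwr := hw.trans (min_le_left _ _)
    refine ⟨(hα _ (hball w hwr)).1, fun t ht ↦ ?_⟩
    have ht₀ : t ∈ Set.Ioo (-ε₀) ε₀ :=
      ⟨by linarith [ht.1, min_le_left ε₀ ε₁], ht.2.trans_le (min_le_left _ _)⟩
    have ht₁ : dist t 0 < ε₁ := by
      rw [Real.dist_0_eq_abs, abs_lt]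
      exact ⟨by linarith [ht.1, min_le_right ε₀ ε₁], ht.2.trans_le (min_le_right _ _)⟩
    refine ⟨hderiv w hwr t ht₀, hηt ?_⟩
    have h1 := hε₁' ht₁
    have h2 := (hL t ⟨by linarith [ht₀.1], by linarith [ht₀.2]⟩).dist_le_mul _ (hball w hwr) _
      (hball 0 h0r)
    have h3 : dist ((u₀, w) : E × E) (u₀, 0) = ‖w‖ := by
      rw [Prod.dist_eq]; simp
    have h4 : (L : ℝ) * ‖w‖ < η / 2 := by
      have h5 : ‖w‖ ≤ η / (2 * (L + 1)) := hw.trans (min_le_right _ _)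
      have hL0 : (0 : ℝ) ≤ L := L.2
      have h6 : (L : ℝ) * ‖w‖ ≤ L * (η / (2 * (L + 1))) := mul_le_mul_of_nonneg_left h5 hL0
      have h7 : (L : ℝ) * (η / (2 * (L + 1))) < η / 2 := by
        rw [← mul_div_assoc, div_lt_div_iff₀ (by positivity) (by positivity)]
        nlinarith
      linarith
    rw [h3] at h2
    have h5 := dist_triangle (α (u₀, w) t) (α (u₀, 0) t) (u₀, 0)
    have h6 : dist (α (u₀, w) t).1 u₀ ≤ dist (α (u₀, w) t) (u₀, 0) := by
      rw [Prod.dist_eq]; exact le_max_left _ _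
    rw [Metric.mem_ball]
    linarith
  · intro t ht w₁ w₂ h₁ h₂
    have h2 := (hL t ⟨by linarith [ht.1, min_le_left ε₀ ε₁],
      by linarith [ht.2, min_le_left ε₀ ε₁]⟩).dist_le_mul _
      (hball w₁ (h₁.trans (min_le_left _ _))) _ (hball w₂ (h₂.trans (min_le_left _ _)))
    have h3 : dist ((u₀, w₁) : E × E) (u₀, w₂) = dist w₁ w₂ := by
      rw [Prod.dist_eq]; simp
    rwa [h3] at h2

/-- Near the origin, the exponential map, read in the chart around `O`, is Lipschitz. -/
theorem exists_lipschitzOnWith_expMap [T2Space M] (O : M) :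
    ∃ U ∈ 𝓝 (0 : E), ∃ L : NNReal,
      (∀ w ∈ U ∩ expDomain g O, expMap g O w ∈ (chartAt E O).source) ∧
      LipschitzOnWith L (fun w ↦ extChartAt 𝓘(ℝ, E) O (expMap g O w)) (U ∩ expDomain g O) := by
  obtain ⟨ε₀, hε₀, δ, hδ, L, α, hα, hL⟩ := exists_geodesic_flow g O
  set ε := ε₀ / 2 with hε_def
  have hε : 0 < ε := half_pos hε₀
  have hIcc : ∀ t ∈ Set.Icc 0 ε, t ∈ Set.Ioo (-ε₀) ε₀ := fun t ht ↦
    ⟨by linarith [ht.1], by linarith [ht.2]⟩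
  have hεmem : ε ∈ Set.Ioo (-ε₀) ε₀ := hIcc ε ⟨hε.le, le_rfl⟩
  -- Time `1` at velocity `w` is time `ε` at velocity `ε⁻¹ • w`, so for small `w` the exponential
  -- map is read off from the local flow at the fixed time `ε`. The Lipschitz constant becomes `L *
  -- ε⁻¹`.
  have key : ∀ w ∈ expDomain g O, ‖ε⁻¹ • w‖ ≤ δ →
      expMap g O w = (extChartAt 𝓘(ℝ, E) O).symm (α (ε⁻¹ • w) ε).1 := by
    intro w hw hwδ
    obtain ⟨c, hc⟩ := hw
    obtain ⟨hO, hd⟩ := hc.start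
    rw [hc.expMap_eq]
    obtain ⟨⟨s, hs, hIs, hg⟩, -⟩ := hc
    set w' : E := ε⁻¹ • w with hw'
    obtain ⟨hα0, hαt⟩ := hα w' hwδ
    set c₁ : ℝ → M := fun t ↦ c (ε⁻¹ * t) with hc₁
    set c₂ : ℝ → M := fun t ↦ (extChartAt 𝓘(ℝ, E) O).symm (α w' t).1 with hc₂
    have hg₁ : IsGeodesicOn g c₁ ((fun r ↦ ε⁻¹ * r) ⁻¹' s) := hg.comp_mul_left ε⁻¹
    have hs₁ : IsOpen ((fun r ↦ ε⁻¹ * r) ⁻¹' s) := hs.preimage (continuous_const_mul _)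
    have hsub : ∀ t ∈ Set.Icc 0 ε, t ∈ (fun r ↦ ε⁻¹ * r) ⁻¹' s := by
      intro t ht
      refine hIs ⟨mul_nonneg (inv_nonneg.2 hε.le) ht.1, ?_⟩
      rw [inv_mul_le_iff₀ hε, mul_one]
      exact ht.2
    have hsrc₂ : ∀ t ∈ Set.Ioo (-ε₀) ε₀, c₂ t ∈ (chartAt E O).source := by
      intro t ht
      rw [← extChartAt_source 𝓘(ℝ, E)]
      exact (extChartAt 𝓘(ℝ, E) O).map_target (hαt t ht).2
    have hphase : ∀ t ∈ Set.Ioo (-ε₀) ε₀, phaseCurve O c₂ t = α w' t := by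
      intro t ht
      have h1 : (fun r ↦ extChartAt 𝓘(ℝ, E) O (c₂ r)) =ᶠ[𝓝 t] fun r ↦ (α w' r).1 := by
        filter_upwards [isOpen_Ioo.mem_nhds ht] with r hr
        exact (extChartAt 𝓘(ℝ, E) O).right_inv (hαt r hr).2
      have h2 : HasDerivAt (fun r ↦ (α w' r).1) (α w' t).2 t := by
        exact (hasFDerivAt_fst.comp_hasDerivAt t (hαt t ht).1)
      exact Prod.ext h1.self_of_nhds (h1.deriv_eq.trans h2.deriv)
    have hsol₂ : ∀ t ∈ Set.Ioo (-ε₀) ε₀, SolvesGeodesicAt g O c₂ t := by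
      intro t ht
      filter_upwards [isOpen_Ioo.mem_nhds ht] with r hr
      refine ⟨hsrc₂ r hr, ?_⟩
      rw [hphase r hr]
      refine (hαt r hr).1.congr_of_eventuallyEq ?_
      filter_upwards [isOpen_Ioo.mem_nhds hr] with r' hr'
      exact hphase r' hr'
    have hsol₁ : ∀ t ∈ Set.Icc 0 ε, c₁ t ∈ (chartAt E O).source → SolvesGeodesicAt g O c₁ t :=
      fun t ht hx ↦ hg₁.solvesGeodesicAt hs₁ (hsub t ht) hx
    have h0mem : (0 : ℝ) ∈ Set.Icc 0 ε := ⟨le_rfl, hε.le⟩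
    have hc₁0 : c₁ 0 = O := by simp only [hc₁, mul_zero, hO]
    have hphase₁ : phaseCurve O c₁ 0 = (extChartAt 𝓘(ℝ, E) O O, w') := by
      refine Prod.ext (congrArg (extChartAt 𝓘(ℝ, E) O) hc₁0) ?_
      have h1 := deriv_comp_mul_left ε⁻¹ (fun r ↦ extChartAt 𝓘(ℝ, E) O (c r)) 0
      rw [mul_zero, hd] at h1
      exact h1
    have hev : c₁ =ᶠ[𝓝 0] c₂ := by
      refine (hsol₁ 0 h0mem (by rw [hc₁0]; exact mem_chart_source E O)).eventuallyEq
        (hsol₂ 0 (hIcc 0 h0mem)) ?_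
      rw [hphase 0 (hIcc 0 h0mem), hα0, hphase₁]
    have h := (geodesic_unique (g := g) h0mem hev
      (fun t ht ↦ (hg₁.contMDiffAt hs₁ (hsub t ht)).continuousAt)
      (fun t ht ↦ (hsol₂ t (hIcc t ht)).continuousAt)
      (fun t ht heq ↦ ⟨O, hsol₁ t ht (by rw [heq]; exact hsrc₂ t (hIcc t ht)),
        hsol₂ t (hIcc t ht)⟩) ε ⟨hε.le, le_rfl⟩).self_of_nhds
    simp only [hc₁, hc₂, inv_mul_cancel₀ hε.ne'] at h
    exact h
  refine ⟨Metric.ball 0 (ε * δ), Metric.ball_mem_nhds _ (mul_pos hε hδ),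
    L * ⟨ε⁻¹, inv_nonneg.2 hε.le⟩, ?_, ?_⟩
  all_goals
    have hsmall : ∀ w ∈ Metric.ball (0 : E) (ε * δ), ‖ε⁻¹ • w‖ ≤ δ := by
      intro w hw
      rw [mem_ball_zero_iff] at hw
      rw [norm_smul, Real.norm_of_nonneg (inv_nonneg.2 hε.le), inv_mul_le_iff₀ hε]
      exact hw.le
  · rintro w ⟨hw, hwd⟩
    rw [key w hwd (hsmall w hw), ← extChartAt_source 𝓘(ℝ, E)]
    exact (extChartAt 𝓘(ℝ, E) O).map_target ((hα _ (hsmall w hw)).2 ε hεmem).2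
  · refine LipschitzOnWith.of_dist_le_mul ?_
    rintro w₁ ⟨hw₁, hwd₁⟩ w₂ ⟨hw₂, hwd₂⟩
    rw [key w₁ hwd₁ (hsmall w₁ hw₁), key w₂ hwd₂ (hsmall w₂ hw₂),
      (extChartAt 𝓘(ℝ, E) O).right_inv ((hα _ (hsmall w₁ hw₁)).2 ε hεmem).2,
      (extChartAt 𝓘(ℝ, E) O).right_inv ((hα _ (hsmall w₂ hw₂)).2 ε hεmem).2]
    have h1 := hL ε hεmem _ _ (hsmall w₁ hw₁) (hsmall w₂ hw₂)
    rw [dist_smul₀, Real.norm_of_nonneg (inv_nonneg.2 hε.le), ← mul_assoc] at h1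
    refine le_trans ?_ h1
    rw [Prod.dist_eq]
    exact le_max_left _ _

end Geodesics

/-- A function on `(0, 1]` with constant derivative and a limit at `0`. -/
theorem eq_limit_add_of_hasDerivAt {f : ℝ → ℝ} {k l : ℝ}
    (hf : ∀ t ∈ Set.Ioc (0 : ℝ) 1, HasDerivAt f k t)
    (hl : Filter.Tendsto f (𝓝[>] 0) (𝓝 l)) : f 1 = l + k := by
  have h1 : ∀ ε ∈ Set.Ioc (0 : ℝ) 1, f 1 - k = f ε - k * ε := by
    intro ε hε
    have h2 : ∀ t ∈ Set.Icc ε 1, HasDerivAt (fun t ↦ f t - k * t) 0 t := by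
      intro t ht
      have h3 := (hf t ⟨hε.1.trans_le ht.1, ht.2⟩).fun_sub ((hasDerivAt_id' t).const_mul k)
      rwa [mul_one, sub_self] at h3
    have h3 := constant_of_has_deriv_right_zero (f := fun t ↦ f t - k * t) (a := ε) (b := 1)
      (fun t ht ↦ (h2 t ht).continuousAt.continuousWithinAt)
      (fun t ht ↦ (h2 t ⟨ht.1, ht.2.le⟩).hasDerivWithinAt) 1 ⟨hε.2, le_rfl⟩
    simpa using h3
  have h4 : Filter.Tendsto (fun ε ↦ f ε - k * ε) (𝓝[>] 0) (𝓝 (l - k * 0)) :=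
    hl.sub ((continuous_const_mul k).continuousAt.mono_left nhdsWithin_le_nhds)
  have h5 : Filter.Tendsto (fun ε ↦ f ε - k * ε) (𝓝[>] 0) (𝓝 (f 1 - k)) := by
    refine tendsto_const_nhds.congr' ?_
    filter_upwards [Ioc_mem_nhdsGT (zero_lt_one' ℝ)] with ε hε
    exact h1 ε hε
  have h6 := tendsto_nhds_unique h4 h5
  linarith

/-! ### The Gauss lemma. -/

section Gauss

variable {E : Type*} [NormedAddCommGroup E] [NormedSpace ℝ E]
  {M : Type*} [TopologicalSpace M] [ChartedSpace E M]

theorem continuousAt_deriv_of_contDiffAt {γ : ℝ → E} {t : ℝ} (hγ : ContDiffAt ℝ ∞ γ t) :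
    ContinuousAt (deriv γ) t := by
  have h : ContDiffAt ℝ ∞ (deriv γ) t :=
    (hγ.fderiv_right (m := ∞) (by simp)).clm_apply (contDiffAt_const (c := (1 : ℝ)))
  exact h.continuousAt

theorem hasDerivAt_comp_ray {D : Type*} [NormedAddCommGroup D] [NormedSpace ℝ D]
    {F : E → D} {y : E} {t : ℝ} (hF : DifferentiableAt ℝ F (t • y)) :
    HasDerivAt (fun r : ℝ ↦ F (r • y)) (fderiv ℝ F (t • y) y) t := by
  have h1 : HasDerivAt (fun r : ℝ ↦ r • y) y t := by
    simpa using (hasDerivAt_id t).smul_const y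
  exact HasFDerivAt.comp_hasDerivAt (l := F) t hF.hasFDerivAt h1

theorem PartialDiffeomorph.contMDiffAt {Φ : PartialDiffeomorph 𝓘(ℝ, E) 𝓘(ℝ, E) E M ∞} {y : E}
    (hy : y ∈ Φ.source) :
    ContMDiffAt 𝓘(ℝ, E) 𝓘(ℝ, E) ∞ Φ y :=
  Φ.contMDiffOn_toFun.contMDiffAt (Φ.open_source.mem_nhds hy)

variable [IsManifold 𝓘(ℝ, E) ∞ M]

/-- The partial diffeomorphism `Φ` is the restriction of the exponential map to an open set that is
star-shaped around the origin (which need not belong to it). -/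
structure IsExpChart (g : LorentzMetric E M) (O : M)
    (Φ : PartialDiffeomorph 𝓘(ℝ, E) 𝓘(ℝ, E) E M ∞) : Prop where
  subset : Φ.source ⊆ expDomain g O
  eqOn : Set.EqOn Φ (expMap g O) Φ.source
  star : ∀ y ∈ Φ.source, ∀ t ∈ Set.Ioc (0 : ℝ) 1, t • y ∈ Φ.source

variable [FiniteDimensional ℝ E] {g : LorentzMetric E M} {O : M}
  {Φ : PartialDiffeomorph 𝓘(ℝ, E) 𝓘(ℝ, E) E M ∞}

theorem contDiffAt_pullTensor_source {y : E} (hy : y ∈ Φ.source) :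
    ContDiffAt ℝ ∞ (pullTensor Φ g.val) y :=
  contDiffAt_pullTensor g Φ.open_source Φ.contMDiffOn_toFun hy

theorem differentiableAt_pullTensor_source {y : E} (hy : y ∈ Φ.source) :
    DifferentiableAt ℝ (pullTensor Φ g.val) y :=
  (contDiffAt_pullTensor_source hy).differentiableAt (by simp)

/-- Along a ray, `Φ` is the geodesic with the corresponding initial velocity. -/
theorem IsExpChart.eventually_eq_curve [T2Space M] (h : IsExpChart g O Φ) {y : E}
    (hy : y ∈ Φ.source) :
    ∃ c : ℝ → M, ∃ s : Set ℝ, IsOpen s ∧ Set.Icc 0 1 ⊆ s ∧ IsGeodesicOn g c s ∧ c 0 = O ∧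
      deriv (fun r ↦ extChartAt 𝓘(ℝ, E) O (c r)) 0 = y ∧
      ∀ t ∈ Set.Ioc (0 : ℝ) 1, ∀ᶠ r in 𝓝 t, Φ (r • y) = c r := by
  obtain ⟨c, hc⟩ := h.subset hy
  obtain ⟨hO, hd⟩ := hc.start
  obtain ⟨⟨s, hs, hIs, hg⟩, h0⟩ := hc
  refine ⟨c, s, hs, hIs, hg, hO, hd, ?_⟩
  obtain ⟨η, hη, hηs⟩ := Metric.isOpen_iff.1 hs 1 (hIs (by simp))
  intro t ht
  have hcone : ∀ᶠ r : ℝ in 𝓝 t, r • y ∈ Φ.source := by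
    have : ContinuousAt (fun r : ℝ ↦ r • y) t := by fun_prop
    exact this (Φ.open_source.mem_nhds (h.star y hy t ht))
  filter_upwards [hcone, lt_mem_nhds ht.1, gt_mem_nhds (show t < 1 + η by linarith [ht.2])]
    with r hr hr0 hr1
  rw [h.eqOn hr]
  refine hg.expMap_smul hs hr0.le ?_ h0
  intro x hx
  rcases le_or_gt x 1 with hx1 | hx1
  · exact hIs ⟨hx.1, hx1⟩
  · refine hηs ?_
    rw [Metric.mem_ball, Real.dist_eq, abs_lt]
    constructor <;> linarith [hx.2]

/-- The geodesic equation for the rays in normal coordinates. -/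
theorem IsExpChart.radial_geodesic [T2Space M] (h : IsExpChart g O Φ) {y : E}
    (hy : y ∈ Φ.source) (z : E) :
    2 * fderiv ℝ (pullTensor Φ g.val) y y y z = fderiv ℝ (pullTensor Φ g.val) y z y y := by
  obtain ⟨c, s, hs, hIs, hg, -, -, hcΦ⟩ := h.eventually_eq_curve hy
  have hcΦ1 := hcΦ 1 (by simp)
  set p : M := Φ y with hp
  have hc1 : c 1 = p := by
    have := hcΦ1.self_of_nhds
    rw [one_smul] at this
    exact this.symm
  set θ : E → E := fun w ↦ extChartAt 𝓘(ℝ, E) p (Φ w) with hθ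
  have hps : Φ y ∈ (chartAt E p).source := mem_chart_source E p
  have hθc : ContDiffAt ℝ ∞ θ y :=
    contDiffAt_extChartAt_comp (PartialDiffeomorph.contMDiffAt hy) hps
  have hθ2 : ContDiffAt ℝ 2 θ y := hθc.of_le (by norm_cast)
  have htgt : θ y ∈ (extChartAt 𝓘(ℝ, E) p).target := mem_extChartAt_target p
  have hGd : DifferentiableAt ℝ (coordTensor p g.val) (θ y) :=
    (contDiffAt_coordTensor g htgt).differentiableAt (by simp)
  have hpull : pullTensor Φ g.val =ᶠ[𝓝 y] flatPull θ (coordTensor p g.val) := by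
    have h1 : ∀ᶠ w in 𝓝 y, Φ w ∈ (chartAt E p).source :=
      (PartialDiffeomorph.contMDiffAt hy).continuousAt ((chartAt E p).open_source.mem_nhds hps)
    filter_upwards [Φ.open_source.mem_nhds hy, h1] with w hw hw'
    exact pullTensor_eq_flatPull
      ((PartialDiffeomorph.contMDiffAt hw).mdifferentiableAt (by simp)) hw'
  rw [hpull.fderiv_eq, fderiv_flatPull hθ2 hGd, fderiv_flatPull hθ2 hGd]
  set γ : ℝ → E := fun r ↦ extChartAt 𝓘(ℝ, E) p (c r) with hγ
  have hγθ : γ =ᶠ[𝓝 1] fun r ↦ θ (r • y) := by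
    filter_upwards [hcΦ1] with r hr
    simp only [hγ, hθ, hr]
  have hray : Filter.Tendsto (fun r : ℝ ↦ r • y) (𝓝 1) (𝓝 y) := by
    have : ContinuousAt (fun r : ℝ ↦ r • y) 1 := by fun_prop
    simpa [ContinuousAt] using this
  have hθd : ∀ᶠ w in 𝓝 y, DifferentiableAt ℝ θ w :=
    (hθ2.eventually (by simp)).mono fun w hw ↦ hw.differentiableAt (by norm_num)
  have hγ' : deriv γ =ᶠ[𝓝 1] fun r ↦ fderiv ℝ θ (r • y) y := by
    filter_upwards [hγθ.eventually_nhds, hray.eventually hθd] with r hr hr'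
    rw [Filter.EventuallyEq.deriv_eq hr]
    exact (hasDerivAt_comp_ray hr').deriv
  have hγ'' : deriv (deriv γ) 1 = fderiv ℝ (fderiv ℝ θ) y y y := by
    rw [hγ'.deriv_eq]
    have hd2 : HasFDerivAt (fun w ↦ fderiv ℝ θ w y) ((fderiv ℝ (fderiv ℝ θ) y).flip y) y := by
      simpa using (differentiableAt_fderiv hθ2).hasFDerivAt.clm_apply (hasFDerivAt_const y y)
    have hd3 : DifferentiableAt ℝ (fun w ↦ fderiv ℝ θ w y) ((1 : ℝ) • y) := by
      rw [one_smul]; exact hd2.differentiableAt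
    rw [(hasDerivAt_comp_ray hd3).deriv, one_smul, hd2.fderiv]
    rfl
  have hgeo := hg.2 1 (hIs (by simp)) p (by rw [hc1]; exact hps)
  change deriv (deriv γ) 1 + christoffel g p (γ 1) (deriv γ 1) (deriv γ 1) = 0 at hgeo
  have h1 : γ 1 = θ y := by simp only [hγ, hθ, hc1, ← hp]
  have h2 : deriv γ 1 = fderiv ℝ θ y y := by simpa using hγ'.self_of_nhds
  rw [hγ'', h1, h2] at hgeo
  have hsymm : ∀ v w, fderiv ℝ (fderiv ℝ θ) y v w = fderiv ℝ (fderiv ℝ θ) y w v :=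
    hθ2.isSymmSndFDerivAt (by simp)
  -- The geodesic equation replaces the second derivative of `θ` on `(y, y)` by `-Γ`, which the
  -- Koszul formula turns into first derivatives of the metric.
  have hΓ := coordTensor_christoffel g htgt (fderiv ℝ θ y y) (fderiv ℝ θ y y) (fderiv ℝ θ y z)
  rw [eq_neg_of_add_eq_zero_left hgeo, map_neg, neg_apply, hΓ, hsymm z y,
    coordTensor_symm g p _ (fderiv ℝ (fderiv ℝ θ) y y z)]
  ring

/-- The metric along a ray, in the chart around `O`, near the starting point. -/
theorem IsExpChart.eventually_pullTensor_ray [T2Space M] (h : IsExpChart g O Φ) {y : E}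
    (hy : y ∈ Φ.source) :
    ∃ γ : ℝ → E, ContDiffAt ℝ ∞ γ 0 ∧ γ 0 = extChartAt 𝓘(ℝ, E) O O ∧ deriv γ 0 = y ∧
      ∃ K : ℝ, ∀ᶠ t in 𝓝[>] (0 : ℝ), ∃ A : E →L[ℝ] E, ‖A‖ ≤ K ∧ A y = deriv γ t ∧
        pullTensor Φ g.val (t • y) = pullbackForm (coordTensor O g.val (γ t)) A := by
  obtain ⟨c, s, hs, hIs, hg, hO, hd, hcΦ⟩ := h.eventually_eq_curve hy
  obtain ⟨U, hU, L, hUsrc, hUL⟩ := exists_lipschitzOnWith_expMap g O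
  have h0s : (0 : ℝ) ∈ s := hIs (by simp)
  have hx : c 0 ∈ (chartAt E O).source := by rw [hO]; exact mem_chart_source E O
  refine ⟨fun r ↦ extChartAt 𝓘(ℝ, E) O (c r),
    contDiffAt_extChartAt_curve (hg.contMDiffAt hs h0s) hx,
    congrArg (extChartAt 𝓘(ℝ, E) O) hO, hd, L, ?_⟩
  have hUray : ∀ᶠ t : ℝ in 𝓝[>] 0, t • y ∈ interior U := by
    have h1 : ContinuousAt (fun r : ℝ ↦ r • y) 0 := by fun_prop
    have h2 : interior U ∈ 𝓝 ((0 : ℝ) • y) := by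
      rw [zero_smul]
      exact interior_mem_nhds.2 hU
    exact nhdsWithin_le_nhds (h1 h2)
  filter_upwards [hUray, Ioc_mem_nhdsGT (zero_lt_one' ℝ)] with t htU ht
  have htC := h.star y hy t ht
  have hV : interior U ∩ Φ.source ∈ 𝓝 (t • y) :=
    Filter.inter_mem (isOpen_interior.mem_nhds htU) (Φ.open_source.mem_nhds htC)
  have hsrc : Φ (t • y) ∈ (chartAt E O).source := by
    rw [h.eqOn htC]
    exact hUsrc _ ⟨interior_subset htU, h.subset htC⟩
  have hmd : MDifferentiableAt 𝓘(ℝ, E) 𝓘(ℝ, E) Φ (t • y) :=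
    (PartialDiffeomorph.contMDiffAt htC).mdifferentiableAt (by simp)
  set θ : E → E := fun w ↦ extChartAt 𝓘(ℝ, E) O (Φ w) with hθ
  have hθd : DifferentiableAt ℝ θ (t • y) := differentiableAt_extChartAt_comp hmd hsrc
  refine ⟨fderiv ℝ θ (t • y), ?_, ?_, ?_⟩
  -- The Lipschitz constant bounds the derivative uniformly as `t → 0`. It stands in for smoothness
  -- at the origin, which `Φ.source` need not contain.
  · refine norm_fderiv_le_of_lipschitzOn ℝ hV (C := L) ?_
    intro w₁ hw₁ w₂ hw₂
    simp only [hθ, h.eqOn hw₁.2, h.eqOn hw₂.2]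
    exact hUL ⟨interior_subset hw₁.1, h.subset hw₁.2⟩ ⟨interior_subset hw₂.1, h.subset hw₂.2⟩
  · have h1 : (fun r ↦ extChartAt 𝓘(ℝ, E) O (c r)) =ᶠ[𝓝 t] fun r ↦ θ (r • y) := by
      filter_upwards [hcΦ t ht] with r hr
      simp only [hθ, hr]
    rw [h1.deriv_eq]
    exact (hasDerivAt_comp_ray hθd).deriv.symm
  · rw [pullTensor_eq_flatPull hmd hsrc, ← (hcΦ t ht).self_of_nhds]
    rfl

theorem continuousAt_coordTensor_comp {γ : ℝ → E} (hγ : ContinuousAt γ 0)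
    (hγ0 : γ 0 = extChartAt 𝓘(ℝ, E) O O) :
    ContinuousAt (fun t ↦ coordTensor O g.val (γ t)) 0 := by
  have h : ContinuousAt (coordTensor O g.val) (γ 0) := by
    rw [hγ0]
    exact (contDiffAt_coordTensor g (mem_extChartAt_target O)).continuousAt
  exact ContinuousAt.comp (g := coordTensor O g.val) h hγ

/-- The norm of the radial vector. -/
theorem IsExpChart.radial_norm [T2Space M] (h : IsExpChart g O Φ) {y : E} (hy : y ∈ Φ.source) :
    pullTensor Φ g.val y y y = (g.val O : E →L[ℝ] E →L[ℝ] ℝ) y y := by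
  obtain ⟨γ, hγ, hγ0, hγ'0, K, hK⟩ := h.eventually_pullTensor_ray hy
  have hder : ∀ t ∈ Set.Ioc (0 : ℝ) 1,
      HasDerivAt (fun t : ℝ ↦ pullTensor Φ g.val (t • y) y y) 0 t := by
    intro t ht
    have htC := h.star y hy t ht
    -- With the radial vector itself as test vector the identity reads `2a = a`, so the squared
    -- length of `y` is constant along the ray.
    have h1 := h.radial_geodesic htC (t • y)
    have h2 : fderiv ℝ (pullTensor Φ g.val) (t • y) y y y = 0 := by
      simp only [map_smul, smul_apply, smul_eq_mul] at h1
      have h3 : t * (t * (t * fderiv ℝ (pullTensor Φ g.val) (t • y) y y y)) = 0 := by linarith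
      simpa [ht.1.ne'] using h3
    have hd := differentiableAt_pullTensor_source (g := g) htC
    have h4 : HasDerivAt (fun r : ℝ ↦ pullTensor Φ g.val (r • y))
        (fderiv ℝ (pullTensor Φ g.val) (t • y) y) t :=
      hasDerivAt_comp_ray (F := pullTensor Φ g.val) hd
    have h5 := (h4.clm_apply (hasDerivAt_const t y)).clm_apply (hasDerivAt_const t y)
    simpa [h2] using h5
  have hγ'c := continuousAt_deriv_of_contDiffAt hγ
  have hGc := continuousAt_coordTensor_comp (g := g) hγ.continuousAt hγ0
  have hlim : Filter.Tendsto (fun t : ℝ ↦ pullTensor Φ g.val (t • y) y y) (𝓝[>] 0)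
      (𝓝 (coordTensor O g.val (γ 0) (deriv γ 0) (deriv γ 0))) := by
    have h1 : ContinuousAt (fun t ↦ coordTensor O g.val (γ t) (deriv γ t) (deriv γ t)) 0 :=
      (hGc.clm_apply hγ'c).clm_apply hγ'c
    refine (h1.tendsto.mono_left nhdsWithin_le_nhds).congr' ?_
    filter_upwards [hK] with t ⟨A, _, hA, hp⟩
    rw [hp, pullbackForm_apply, hA]
  have := eq_limit_add_of_hasDerivAt hder hlim
  rw [hγ0, hγ'0, ← coordTensor_self, one_smul, add_zero] at this
  exact this

/-- **Gauss lemma**: in normal coordinates, the scalar products with the radial vector are the same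
for the metric and for its value at the centre. -/
theorem IsExpChart.gauss [T2Space M] (h : IsExpChart g O Φ) {y : E} (hy : y ∈ Φ.source) (z : E) :
    pullTensor Φ g.val y y z = (g.val O : E →L[ℝ] E →L[ℝ] ℝ) y z := by
  obtain ⟨γ, hγ, hγ0, hγ'0, K, hK⟩ := h.eventually_pullTensor_ray hy
  set η : E →L[ℝ] E →L[ℝ] ℝ := g.val O with hη
  have hηsymm : ∀ v w, η v w = η w v := g.symm O
  have hder : ∀ t ∈ Set.Ioc (0 : ℝ) 1,
      HasDerivAt (fun t : ℝ ↦ pullTensor Φ g.val (t • y) (t • y) z) (η y z) t := by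
    intro t ht
    have htC := h.star y hy t ht
    have hd := differentiableAt_pullTensor_source (g := g) htC
    have h1 := h.radial_geodesic htC z
    -- `radial_norm` holds on an open set, so it may be differentiated in the direction `z`.
    -- Together with `radial_geodesic` this gives the derivative of `G_{ty}(ty, z)` in `t`.
    have h2 : fderiv ℝ (pullTensor Φ g.val) (t • y) z (t • y) (t • y) +
        2 * pullTensor Φ g.val (t • y) (t • y) z = 2 * η (t • y) z := by
      have h3 := (hd.hasFDerivAt.clm_apply (hasFDerivAt_id (t • y))).clm_apply
        (hasFDerivAt_id (t • y))
      have h4 := ((η.hasFDerivAt (x := t • y)).clm_apply (hasFDerivAt_id (t • y)))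
      have h5 := h3.congr_of_eventuallyEq (f₁ := fun w ↦ η w w) (by
        filter_upwards [Φ.open_source.mem_nhds htC] with w hw
        exact (h.radial_norm hw).symm)
      have h6 := congrArg (fun B ↦ B z) (h5.unique h4)
      simp at h6
      simp only [map_smul, smul_apply, smul_eq_mul]
      rw [pullTensor_symm g _ _ z y, hηsymm z y] at h6
      linarith
    simp only [map_smul, smul_apply, smul_eq_mul] at h1 h2
    have h3 : t * fderiv ℝ (pullTensor Φ g.val) (t • y) y y z +
        pullTensor Φ g.val (t • y) y z = η y z := by
      have h4 : t * (t * fderiv ℝ (pullTensor Φ g.val) (t • y) y y z +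
        pullTensor Φ g.val (t • y) y z) = t * η y z := by linarith
      exact mul_left_cancel₀ ht.1.ne' h4
    have h4 : HasDerivAt (fun r : ℝ ↦ pullTensor Φ g.val (r • y))
        (fderiv ℝ (pullTensor Φ g.val) (t • y) y) t :=
      hasDerivAt_comp_ray (F := pullTensor Φ g.val) hd
    have h5 : HasDerivAt (fun r : ℝ ↦ r • y) y t := by
      simpa using (hasDerivAt_id t).smul_const y
    have h6 := (h4.clm_apply h5).clm_apply (hasDerivAt_const t z)
    refine h6.congr_deriv ?_
    rw [← h3]
    simp
  have hγ'c := continuousAt_deriv_of_contDiffAt hγ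
  have hGc := continuousAt_coordTensor_comp (g := g) hγ.continuousAt hγ0
  -- The factor `t` wins: `A y` is the velocity of the geodesic, which converges, and `A z` is
  -- bounded.
  have hlim : Filter.Tendsto (fun t : ℝ ↦ pullTensor Φ g.val (t • y) (t • y) z) (𝓝[>] 0)
      (𝓝 0) := by
    have h1 : Filter.Tendsto (fun t : ℝ ↦ |t| * (‖coordTensor O g.val (γ t) (deriv γ t)‖ *
        (K * ‖z‖))) (𝓝[>] 0) (𝓝 0) := by
      have h2 : ContinuousAt (fun t : ℝ ↦ |t| * (‖coordTensor O g.val (γ t) (deriv γ t)‖ *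
          (K * ‖z‖))) 0 :=
        continuous_abs.continuousAt.mul (((hGc.clm_apply hγ'c).norm).mul continuousAt_const)
      have h3 := h2.tendsto
      rw [abs_zero, zero_mul] at h3
      exact h3.mono_left nhdsWithin_le_nhds
    refine squeeze_zero_norm' ?_ h1
    filter_upwards [hK] with t ⟨A, hAK, hA, hp⟩
    have h3 : pullTensor Φ g.val (t • y) (t • y) z =
        t * coordTensor O g.val (γ t) (deriv γ t) (A z) := by
      rw [hp, map_smul, smul_apply, smul_eq_mul, pullbackForm_apply, hA]
    rw [h3, norm_mul, Real.norm_eq_abs]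
    refine mul_le_mul_of_nonneg_left ?_ (abs_nonneg t)
    refine (ContinuousLinearMap.le_opNorm _ _).trans ?_
    refine mul_le_mul_of_nonneg_left ?_ (norm_nonneg _)
    exact (A.le_opNorm z).trans (mul_le_mul_of_nonneg_right hAK (norm_nonneg z))
  have := eq_limit_add_of_hasDerivAt hder hlim
  rwa [one_smul, zero_add] at this

end Gauss

/-! ### The Minkowski form in the frame, and the cone over the hyperboloid. -/

theorem eta_form_apply {E : Type*} [NormedAddCommGroup E] [NormedSpace ℝ E]
    {η : E →L[ℝ] E →L[ℝ] ℝ} (e : Module.Basis (Fin 4) ℝ E)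
    (he : ∀ a b, η (e a) (e b) = eta a b) (v w : E) :
    η v w = -(e.repr v 0 * e.repr w 0) + ∑ i : Fin 3, e.repr v i.succ * e.repr w i.succ := by
  conv_lhs => rw [← e.sum_repr v, ← e.sum_repr w]
  simp only [map_sum, map_smul, sum_apply, smul_apply, smul_eq_mul, he]
  rw [Fin.sum_univ_succ]
  congr 1
  · rw [Finset.sum_eq_single 0]
    · simp [eta, mul_comm]
    · intro b _ hb
      simp [eta, hb]
    · simp
  · refine Finset.sum_congr rfl fun i _ ↦ ?_
    rw [Finset.sum_eq_single i.succ]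
    · simp [eta, mul_comm]
    · intro b _ hb
      simp [eta, hb]
    · simp

theorem sub_sum_sq_eq_neg_form {E : Type*} [NormedAddCommGroup E] [NormedSpace ℝ E]
    {η : E →L[ℝ] E →L[ℝ] ℝ} (e : Module.Basis (Fin 4) ℝ E)
    (he : ∀ a b, η (e a) (e b) = eta a b) (w : E) :
    e.repr w 0 ^ 2 - ∑ i : Fin 3, e.repr w i.succ ^ 2 = -η w w := by
  rw [eta_form_apply e he]
  simp only [pow_two]
  ring

section Cone

variable {E : Type*} [NormedAddCommGroup E] [NormedSpace ℝ E]
  {M : Type*} [TopologicalSpace M] [ChartedSpace E M]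
  {O : M} {e : Module.Basis (Fin 4) ℝ (TangentSpace 𝓘(ℝ, E) O)}

theorem minkSq_smul (r : ℝ) (w : E) : minkSq e (r • w) = r ^ 2 * minkSq e w := by
  have h : ∀ a, comp e (r • w) a = r * comp e w a := fun a ↦ by
    have := congrArg (fun f ↦ f a) ((e : Module.Basis (Fin 4) ℝ E).repr.map_smul r w)
    exact this
  simp only [minkSq, h, mul_pow, ← Finset.mul_sum]
  ring

theorem minkSq_pos_of_mem_hypCone {s : ℝ≥0∞} {w : E} (hw : w ∈ hypCone e s) :
    0 < minkSq e w := by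
  obtain ⟨r, V, hV, hr, -, rfl⟩ := hw
  rw [minkSq_smul, hV.2]
  positivity

theorem smul_mem_hypCone {s : ℝ≥0∞} {w : E} (hw : w ∈ hypCone e s) {t : ℝ}
    (ht : t ∈ Set.Ioc (0 : ℝ) 1) : t • w ∈ hypCone e s := by
  obtain ⟨r, V, hV, hr, hrs, rfl⟩ := hw
  refine ⟨t * r, V, hV, mul_pos ht.1 hr, lt_of_le_of_lt ?_ hrs, smul_smul t r V⟩
  exact ENNReal.ofReal_le_ofReal (mul_le_of_le_one_left hr.le ht.2)

theorem hypCone_mono {s s' : ℝ≥0∞} (h : s ≤ s') : hypCone e s ⊆ hypCone e s' := by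
  rintro w ⟨r, V, hV, hr, hrs, rfl⟩
  exact ⟨r, V, hV, hr, hrs.trans_le h, rfl⟩

theorem PartialDiffeomorph.isInvertible_modelDeriv
    {Φ : PartialDiffeomorph 𝓘(ℝ, E) 𝓘(ℝ, E) E M ∞} {y : E} (hy : y ∈ Φ.source) :
    (modelDeriv Φ y).IsInvertible := by
  have h : IsLocalDiffeomorphAt 𝓘(ℝ, E) 𝓘(ℝ, E) ∞ Φ y := ⟨Φ, hy, fun _ _ ↦ rfl⟩
  exact ⟨h.mfderivToContinuousLinearEquiv (by simp), rfl⟩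

variable [IsManifold 𝓘(ℝ, E) ∞ M] {g : LorentzMetric E M}

theorem minkSq_eq (he : ∀ a b : Fin 4, g.val O (e a) (e b) = eta a b) (w : E) :
    minkSq e w = -(g.val O : E →L[ℝ] E →L[ℝ] ℝ) w w :=
  sub_sum_sq_eq_neg_form (E := E) (η := g.val O) e he w

/-- The supremum `injRadius` need not be attained, so points are treated on strictly smaller cones.
-/
theorem exists_diffeo_of_lt_injRadius {r : ℝ} (hr : ENNReal.ofReal r < injRadius g e) :
    ∃ s : ℝ, ENNReal.ofReal r < ENNReal.ofReal s ∧ ENNReal.ofReal s ≤ injRadius g e ∧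
      ExpIsDiffeoUpTo g e s := by
  obtain ⟨x, ⟨s, hs, hd, rfl⟩, hx⟩ := lt_sSup_iff.1 hr
  exact ⟨s, hx, le_sSup ⟨s, hs, hd, rfl⟩, hd⟩

/-- Any two points lie in one common smaller cone, where the exponential map is a diffeomorphism.
Hence `expInv` is a genuine inverse on the whole cone. -/
theorem injOn_expMap : Set.InjOn (expMap g O) (hypCone e (injRadius g e)) := by
  rintro w₁ ⟨r₁, V₁, hV₁, hr₁, hs₁, rfl⟩ w₂ ⟨r₂, V₂, hV₂, hr₂, hs₂, rfl⟩ heq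
  have hmax : ENNReal.ofReal (max r₁ r₂) < injRadius g e := by
    rcases max_choice r₁ r₂ with h | h <;> rw [h] <;> assumption
  obtain ⟨s, hs, -, -, Φ, hΦ, hEq⟩ := exists_diffeo_of_lt_injRadius hmax
  have h₁ : r₁ • V₁ ∈ hypCone e (ENNReal.ofReal s) :=
    ⟨r₁, V₁, hV₁, hr₁, (ENNReal.ofReal_le_ofReal (le_max_left _ _)).trans_lt hs, rfl⟩
  have h₂ : r₂ • V₂ ∈ hypCone e (ENNReal.ofReal s) :=
    ⟨r₂, V₂, hV₂, hr₂, (ENNReal.ofReal_le_ofReal (le_max_right _ _)).trans_lt hs, rfl⟩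
  rw [← hEq h₁, ← hEq h₂] at heq
  rw [← hΦ] at h₁ h₂
  exact Φ.injOn h₁ h₂ heq

/-- The partial diffeomorphism `Φ` is the restriction of the exponential map to the part of the
cone over the unit hyperboloid up to some radius. -/
structure IsConeChart (g : LorentzMetric E M) {O : M}
    (e : Module.Basis (Fin 4) ℝ (TangentSpace 𝓘(ℝ, E) O))
    (Φ : PartialDiffeomorph 𝓘(ℝ, E) 𝓘(ℝ, E) E M ∞) : Prop extends IsExpChart g O Φ where
  subset_cone : Φ.source ⊆ hypCone e (injRadius g e)

theorem exists_isConeChart {r : ℝ} {V : E} (hV : V ∈ unitHyp e) (hr0 : 0 < r)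
    (hr : ENNReal.ofReal r < injRadius g e) :
    ∃ Φ : PartialDiffeomorph 𝓘(ℝ, E) 𝓘(ℝ, E) E M ∞, IsConeChart g e Φ ∧ r • V ∈ Φ.source := by
  obtain ⟨s, hs, hle, hsub, Φ, hΦ, hEq⟩ := exists_diffeo_of_lt_injRadius hr
  refine ⟨Φ, ⟨⟨hΦ ▸ hsub, hΦ ▸ hEq, ?_⟩, hΦ ▸ hypCone_mono hle⟩, ?_⟩
  · rw [hΦ]
    exact fun y hy t ht ↦ smul_mem_hypCone hy ht
  · rw [hΦ]
    exact ⟨r, V, hV, hr0, hs, rfl⟩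

theorem IsConeChart.expInv_eq {Φ : PartialDiffeomorph 𝓘(ℝ, E) 𝓘(ℝ, E) E M ∞}
    (h : IsConeChart g e Φ) {y : E} (hy : y ∈ Φ.source) :
    expInv g e (Φ y) = y := by
  rw [h.eqOn hy]
  exact injOn_expMap.leftInvOn_invFunOn (h.subset_cone hy)

theorem IsConeChart.rho_eq {Φ : PartialDiffeomorph 𝓘(ℝ, E) 𝓘(ℝ, E) E M ∞}
    (h : IsConeChart g e Φ)
    (he : ∀ a b : Fin 4, g.val O (e a) (e b) = eta a b) {y : E} (hy : y ∈ Φ.source) :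
    rho g e (Φ y) = Real.sqrt (-(g.val O : E →L[ℝ] E →L[ℝ] ℝ) y y) := by
  rw [rho, h.expInv_eq hy, minkSq_eq he]

end Cone

/-! ### Boosts as linear vector fields. -/

section Minkowski

variable {E : Type*} [NormedAddCommGroup E] [NormedSpace ℝ E] [FiniteDimensional ℝ E]

/-- The boost of the vector space `E` with frame `e`, as a continuous linear map. -/
def boostMap (e : Module.Basis (Fin 4) ℝ E) (i : Fin 3) : E →L[ℝ] E :=
  LinearMap.toContinuousLinearMap
    ((e.coord i.succ).smulRight (e 0) + (e.coord 0).smulRight (e i.succ))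

theorem boostMap_apply (e : Module.Basis (Fin 4) ℝ E) (i : Fin 3) (y : E) :
    boostMap e i y = e.repr y i.succ • e 0 + e.repr y 0 • e i.succ := rfl

/-- The boost is an infinitesimal isometry: because `e 0` is time-like and `e i.succ` space-like,
the mixed terms cancel. -/
theorem boostMap_antisymm {η : E →L[ℝ] E →L[ℝ] ℝ} (e : Module.Basis (Fin 4) ℝ E)
    (he : ∀ a b, η (e a) (e b) = eta a b) (i : Fin 3) (v w : E) :
    η (boostMap e i v) w + η v (boostMap e i w) = 0 := by
  have h0 : ∀ w, η (e 0) w = -e.repr w 0 := fun w ↦ by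
    rw [eta_form_apply e he]
    simp
  have hi : ∀ w, η (e i.succ) w = e.repr w i.succ := fun w ↦ by
    rw [eta_form_apply e he]
    simp [Finsupp.single_apply]
  have hs : ∀ v w, η v w = η w v := fun v w ↦ by
    rw [eta_form_apply e he, eta_form_apply e he]
    simp only [mul_comm]
  rw [hs v]
  simp only [boostMap_apply, map_add, map_smul, add_apply, smul_apply, smul_eq_mul, h0, hi]
  ring

theorem flatBoost_eq {M : Type*} [TopologicalSpace M] [ChartedSpace E M] {O : M}
    {e : Module.Basis (Fin 4) ℝ (TangentSpace 𝓘(ℝ, E) O)} (i : Fin 3) (y : E) :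
    flatBoost e i y = boostMap (E := E) e i y := rfl

variable {M : Type*} [TopologicalSpace M] [ChartedSpace E M] [IsManifold 𝓘(ℝ, E) ∞ M]
  {g : LorentzMetric E M} {O : M} {e : Module.Basis (Fin 4) ℝ (TangentSpace 𝓘(ℝ, E) O)}

variable {Φ : PartialDiffeomorph 𝓘(ℝ, E) 𝓘(ℝ, E) E M ∞}

theorem IsConeChart.boost_eq (h : IsConeChart g e Φ) {y : E} (hy : y ∈ Φ.source) (i : Fin 3) :
    modelDeriv Φ y (boostMap (E := E) e i y) = boost g e i (Φ y) := by
  have h1 : modelDeriv (expMap g O) y = modelDeriv Φ y := by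
    have : expMap g O =ᶠ[𝓝 y] Φ := by
      filter_upwards [Φ.open_source.mem_nhds hy] with w hw
      exact (h.eqOn hw).symm
    exact this.mfderiv_eq
  have h2 : boost g e i (Φ y) = modelDeriv (expMap g O) (expInv g e (Φ y))
    (flatBoost (E := E) e i (expInv g e (Φ y))) := rfl
  rw [h2, h.expInv_eq hy, h1, flatBoost_eq]

end Minkowski

/-! ### The field `B` in normal coordinates, and the iterated Lie derivatives. -/

section Main

variable {E : Type*} [NormedAddCommGroup E] [NormedSpace ℝ E]
  {M : Type*} [TopologicalSpace M] [ChartedSpace E M] [IsManifold 𝓘(ℝ, E) ∞ M]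
  {g : LorentzMetric E M} {O : M} {e : Module.Basis (Fin 4) ℝ (TangentSpace 𝓘(ℝ, E) O)}
  {Φ : PartialDiffeomorph 𝓘(ℝ, E) 𝓘(ℝ, E) E M ∞}

/-- The scalar product at the point `O`, as a bilinear form on the model space. -/
def formAt (g : LorentzMetric E M) (O : M) : E →L[ℝ] E →L[ℝ] ℝ := g.val O

theorem formAt_symm (g : LorentzMetric E M) (O : M) (v w : E) : formAt g O v w = formAt g O w v :=
  g.symm O v w

theorem formAt_self_neg_of_mem_hypCone (he : ∀ a b : Fin 4, g.val O (e a) (e b) = eta a b)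
    {s : ℝ≥0∞} {w : E} (hw : w ∈ hypCone e s) : 0 < -formAt g O w w := by
  have h := minkSq_pos_of_mem_hypCone hw
  rwa [minkSq_eq he] at h

/-- The Minkowski radius. -/
def radius (η : E →L[ℝ] E →L[ℝ] ℝ) (y : E) : ℝ := Real.sqrt (-η y y)

theorem hasFDerivAt_radius {η : E →L[ℝ] E →L[ℝ] ℝ} (hη : ∀ v w, η v w = η w v) {y : E}
    (hy : 0 < -η y y) : HasFDerivAt (radius η) (-((radius η y)⁻¹ • η y)) y := by
  have h0 := (η.hasFDerivAt (x := y)).clm_apply (hasFDerivAt_id y)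
  have h1 : HasFDerivAt (fun w ↦ -η w w) _ y := h0.neg
  refine (h1.sqrt hy.ne').congr_fderiv ?_
  ext z
  simp only [smul_apply, neg_apply, add_apply, ContinuousLinearMap.comp_apply,
    ContinuousLinearMap.flip_apply, smul_eq_mul, id_eq, ContinuousLinearMap.id_apply, hη z y,
    radius]
  field_simp
  ring

variable [FiniteDimensional ℝ E]

theorem formAt_boostMap (he : ∀ a b : Fin 4, g.val O (e a) (e b) = eta a b) (i : Fin 3) (v w : E) :
    formAt g O (boostMap (E := E) e i v) w + formAt g O v (boostMap (E := E) e i w) = 0 :=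
  boostMap_antisymm (E := E) (η := formAt g O) e he i v w

theorem formAt_boostMap_self (he : ∀ a b : Fin 4, g.val O (e a) (e b) = eta a b) (i : Fin 3)
    (v : E) : formAt g O v (boostMap (E := E) e i v) = 0 := by
  have h := formAt_boostMap he i v v
  rw [formAt_symm g O _ v] at h
  linarith

/-- The differential of `ρ` is `-ρ⁻¹ η(y, ·)`, which by the Gauss lemma is `-ρ⁻¹` times the metric
dual of `y`. The gradient is therefore `-y / ρ`, and the sign in `B` makes it `y / ρ`. -/
theorem IsConeChart.normalB_eq [T2Space M] (h : IsConeChart g e Φ)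
    (he : ∀ a b : Fin 4, g.val O (e a) (e b) = eta a b) {y : E} (hy : y ∈ Φ.source) :
    modelDeriv Φ y ((radius (formAt g O) y)⁻¹ • y) = normalB g e (Φ y) := by
  set η := formAt g O with hη
  have hpos : 0 < -η y y := formAt_self_neg_of_mem_hypCone he (h.subset_cone hy)
  have hinv := PartialDiffeomorph.isInvertible_modelDeriv hy
  have hrad := hasFDerivAt_radius (formAt_symm g O) hpos
  have hΦmd : MDifferentiableAt 𝓘(ℝ, E) 𝓘(ℝ, E) Φ y :=
    (PartialDiffeomorph.contMDiffAt hy).mdifferentiableAt (by simp)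
  have hΦy : Φ y ∈ Φ.target := Φ.map_source hy
  have hleft : Φ.symm (Φ y) = y := Φ.left_inv hy
  have hρ : rho g e =ᶠ[𝓝 (Φ y)] fun q ↦ radius η (Φ.symm q) := by
    filter_upwards [Φ.open_target.mem_nhds hΦy] with q hq
    have h1 : Φ (Φ.symm q) = q := Φ.right_inv hq
    have h2 : rho g e (Φ (Φ.symm q)) = radius η (Φ.symm q) := h.rho_eq he (Φ.map_target hq)
    rwa [h1] at h2
  have hρmd : MDifferentiableAt 𝓘(ℝ, E) 𝓘(ℝ, ℝ) (rho g e) (Φ y) := by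
    have h1 : MDifferentiableAt 𝓘(ℝ, E) 𝓘(ℝ, E) Φ.symm (Φ y) :=
      (Φ.contMDiffOn_invFun.contMDiffAt (Φ.open_target.mem_nhds hΦy)).mdifferentiableAt (by simp)
    have h2 : MDifferentiableAt 𝓘(ℝ, E) 𝓘(ℝ, ℝ) (radius η) (Φ.symm (Φ y)) := by
      rw [hleft]
      exact hrad.differentiableAt.mdifferentiableAt
    exact (h2.comp (Φ y) h1).congr_of_eventuallyEq hρ
  have hdρ : ∀ z, (mfderiv 𝓘(ℝ, E) 𝓘(ℝ, ℝ) (rho g e) (Φ y) : E →L[ℝ] ℝ) (modelDeriv Φ y z) =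
      -((radius η y)⁻¹ • η y) z := by
    intro z
    have h1 := mfderiv_comp y hρmd hΦmd
    have h2 : rho g e ∘ Φ =ᶠ[𝓝 y] radius η := by
      filter_upwards [Φ.open_source.mem_nhds hy] with w hw
      exact h.rho_eq he hw
    rw [h2.mfderiv_eq, mfderiv_eq_fderiv, hrad.fderiv] at h1
    exact (congrArg (fun A : E →L[ℝ] ℝ ↦ A z) h1).symm
  have key : formAt g (Φ y) (-modelDeriv Φ y ((radius η y)⁻¹ • y)) =
      (mfderiv 𝓘(ℝ, E) 𝓘(ℝ, ℝ) (rho g e) (Φ y) : E →L[ℝ] ℝ) := by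
    refine ContinuousLinearMap.ext fun v ↦ ?_
    obtain ⟨z, rfl⟩ := hinv.surjective v
    refine Eq.trans ?_ (hdρ z).symm
    rw [map_neg, neg_apply]
    refine congrArg (fun a : ℝ ↦ -a) ?_
    have h1 := h.gauss hy z
    rw [pullTensor_apply] at h1
    have h2 : formAt g (Φ y) (modelDeriv Φ y y) (modelDeriv Φ y z) = η y z := h1
    rw [map_smul, map_smul, smul_apply, smul_apply, h2]
  have hGinv : (formAt g (Φ y)).IsInvertible := isInvertible_of_injective (injective_metric g _)
  have hgrad : (gradient g (rho g e) (Φ y) : E) = (formAt g (Φ y)).inverse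
      (mfderiv 𝓘(ℝ, E) 𝓘(ℝ, ℝ) (rho g e) (Φ y) : E →L[ℝ] ℝ) := rfl
  rw [← key, hGinv.inverse_apply_self] at hgrad
  exact ((congrArg (fun v : E ↦ -v) hgrad).trans (neg_neg _)).symm

/-- The iterated Lie derivatives of the deformation tensor, pulled back by `Φ`, are smooth and
annihilate the radial vector. -/
theorem IsConeChart.pullTensor_iterLie [T2Space M] (h : IsConeChart g e Φ)
    (he : ∀ a b : Fin 4, g.val O (e a) (e b) = eta a b) (j : Fin 3) (l : List (Fin 3)) :
    ∀ y ∈ Φ.source,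
      ContDiffAt ℝ ∞ (pullTensor Φ (iterLie g e l (deformation g (boost g e j)))) y ∧
      ∀ z, pullTensor Φ (iterLie g e l (deformation g (boost g e j))) y y z = 0 := by
  -- One Lie derivative, for a tensor that agrees with a boost-invariant form `ζ` once the radial
  -- vector fills the first slot. It is used with `ζ = η` for the metric and with `ζ = 0` ever
  -- after; smoothness is carried along for the next differentiation.
  have step : ∀ (i : Fin 3) (F : Tensor2 E M) (ζ : E →L[ℝ] E →L[ℝ] ℝ),
      (∀ v w, ζ (boostMap (E := E) e i v) w + ζ v (boostMap (E := E) e i w) = 0) →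
      (∀ y ∈ Φ.source, ContDiffAt ℝ ∞ (pullTensor Φ F) y ∧ ∀ z, pullTensor Φ F y y z = ζ y z) →
      ∀ y ∈ Φ.source, ContDiffAt ℝ ∞ (pullTensor Φ (lieDeriv (boost g e i) F)) y ∧
        ∀ z, pullTensor Φ (lieDeriv (boost g e i) F) y y z = 0 := by
    intro i F ζ hζ hF y hy
    have hsrc := Φ.open_source.mem_nhds hy
    have hlie : ∀ w ∈ Φ.source, pullTensor Φ (lieDeriv (boost g e i) F) w =
        flatLie (boostMap (E := E) e i) (pullTensor Φ F) w := by
      intro w hw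
      refine pullTensor_lieDeriv Φ hw ((hF w hw).1.differentiableAt (by simp))
        (boostMap (E := E) e i).differentiableAt ?_
      filter_upwards [Φ.open_source.mem_nhds hw] with w' hw'
      exact h.boost_eq hw' i
    constructor
    · refine (contDiffAt_flatLie (boostMap (E := E) e i).contDiff.contDiffAt
        (hF y hy).1).congr_of_eventuallyEq ?_
      filter_upwards [hsrc] with w hw
      exact hlie w hw
    · intro z
      rw [hlie y hy, flatLie_self_apply (η := ζ) ((hF y hy).1.differentiableAt (by simp)) ?_ z]
      · exact hζ y z
      · filter_upwards [hsrc] with w hw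
        exact (hF w hw).2
  induction l with
  | nil =>
    have h1 := step j g.val (formAt g O) (formAt_boostMap he j) fun y hy ↦
      ⟨contDiffAt_pullTensor_source hy, fun z ↦ h.gauss hy z⟩
    have h2 : iterLie g e [] (deformation g (boost g e j)) = lieDeriv (boost g e j) g.val :=
      deformation_eq_lieDeriv g _
    rw [h2]
    exact h1
  | cons i l ih =>
    exact step i _ 0 (by simp) ih

/-- `B` is a multiple of the radial vector and every `v` is in the image of `dΦ`. The arbitrary
second slot covers both `B` and `R_i` in claim 3. -/
theorem IsConeChart.iterLie_eq_zero [T2Space M] (h : IsConeChart g e Φ)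
    (he : ∀ a b : Fin 4, g.val O (e a) (e b) = eta a b) (j : Fin 3) (l : List (Fin 3))
    {y : E} (hy : y ∈ Φ.source) (v : TangentSpace 𝓘(ℝ, E) (Φ y)) :
    iterLie g e l (deformation g (boost g e j)) (Φ y) (normalB g e (Φ y)) v = 0 := by
  obtain ⟨z, hz⟩ := (PartialDiffeomorph.isInvertible_modelDeriv hy).surjective v
  have h1 := (h.pullTensor_iterLie he j l y hy).2 z
  set F := iterLie g e l (deformation g (boost g e j)) with hF
  have h2 : ∀ b : E, (F (Φ y) : E →L[ℝ] E →L[ℝ] ℝ) (normalB g e (Φ y)) b =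
      (F (Φ y) : E →L[ℝ] E →L[ℝ] ℝ) (modelDeriv Φ y ((radius (formAt g O) y)⁻¹ • y)) b :=
    fun b ↦ congrArg (fun a ↦ (F (Φ y) : E →L[ℝ] E →L[ℝ] ℝ) a b) (h.normalB_eq he hy).symm
  refine (h2 v).trans ?_
  rw [← hz]
  have h3 : pullTensor Φ F y ((radius (formAt g O) y)⁻¹ • y) z = 0 := by
    rw [map_smul, smul_apply, h1, smul_zero]
  exact h3

end Main

/-! ### The unit radial field, and curves in the hyperboloid. -/

section Flat

variable {E : Type*} [NormedAddCommGroup E] [NormedSpace ℝ E]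

/-- `L` is the differential of `1 / ρ`, a multiple of `η(y, ·)`; it vanishes on boosts, which is all
that the bracket computation needs. -/
theorem hasFDerivAt_unitRadial {η : E →L[ℝ] E →L[ℝ] ℝ} (hη : ∀ v w, η v w = η w v) {y : E}
    (hy : 0 < -η y y) : ∃ L : E →L[ℝ] ℝ, (∀ z, η y z = 0 → L z = 0) ∧
      HasFDerivAt (fun w ↦ (radius η w)⁻¹ • w)
        ((radius η y)⁻¹ • ContinuousLinearMap.id ℝ E + L.smulRight y) y := by
  have hr : radius η y ≠ 0 := (Real.sqrt_pos.2 hy).ne'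
  have h1 := (hasDerivAt_inv hr).comp_hasFDerivAt y (hasFDerivAt_radius hη hy)
  refine ⟨_, fun z hz ↦ ?_, h1.smul (hasFDerivAt_id y)⟩
  simp [hz]

theorem contDiffAt_unitRadial {η : E →L[ℝ] E →L[ℝ] ℝ} {y : E} (hy : 0 < -η y y) :
    ContDiffAt ℝ 1 (fun w ↦ (radius η w)⁻¹ • w) y := by
  have h1 : ContDiffAt ℝ 1 (fun w ↦ -η w w) y := by fun_prop
  exact ((h1.sqrt hy.ne').inv (Real.sqrt_pos.2 hy).ne').smul contDiffAt_id

/-- The line `V + t W`, normalized by the factor `1 / √(1 - t² q)`. -/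
def normalizedLine (V W : E) (q t : ℝ) : E := (Real.sqrt (1 - t ^ 2 * q))⁻¹ • (V + t • W)

theorem normalizedLine_zero (V W : E) (q : ℝ) : normalizedLine V W q 0 = V := by
  simp [normalizedLine]

theorem contDiffAt_normalizedLine (V W : E) (q : ℝ) :
    ContDiffAt ℝ ∞ (normalizedLine V W q) 0 := by
  have h1 : ContDiffAt ℝ ∞ (fun t : ℝ ↦ 1 - t ^ 2 * q) 0 := by fun_prop
  have h2 : ContDiffAt ℝ ∞ (fun t : ℝ ↦ V + t • W) 0 := by fun_prop
  exact ((h1.sqrt (by simp)).inv (by simp)).smul h2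

/-- The normalizing factor depends on `t²` only and does not contribute at first order. -/
theorem hasDerivAt_normalizedLine (V W : E) (q : ℝ) :
    HasDerivAt (normalizedLine V W q) W 0 := by
  have h1 : HasDerivAt (fun t : ℝ ↦ 1 - t ^ 2 * q) 0 0 := by
    simpa using ((hasDerivAt_pow 2 (0 : ℝ)).mul_const q).const_sub 1
  have h2 : HasDerivAt (fun t : ℝ ↦ V + t • W) W 0 := by
    simpa using ((hasDerivAt_id (0 : ℝ)).smul_const W).const_add V
  have h3 := ((h1.sqrt (by simp)).inv (by simp)).smul h2
  have h4 : normalizedLine V W q = (fun t ↦ √(1 - t ^ 2 * q))⁻¹ • fun t ↦ V + t • W := rfl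
  rw [h4]
  simpa using h3

theorem continuous_basis_repr [FiniteDimensional ℝ E] {ι : Type*} (b : Module.Basis ι ℝ E) (a : ι) :
    Continuous fun w ↦ b.repr w a :=
  (b.coord a).continuous_of_finiteDimensional

end Flat

/-! ### Vector fields related by a local diffeomorphism. -/

section Related

variable {E : Type*} [NormedAddCommGroup E] [NormedSpace ℝ E]
  {M : Type*} [TopologicalSpace M] [ChartedSpace E M]
  {Φ : PartialDiffeomorph 𝓘(ℝ, E) 𝓘(ℝ, E) E M ∞}

theorem tangentMap_comp_curve {f : E → M} {γ : ℝ → E} {v : E} (hγ : HasDerivAt γ v 0)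
    (hf : MDifferentiableAt 𝓘(ℝ, E) 𝓘(ℝ, E) f (γ 0)) :
    tangentMap 𝓘(ℝ, ℝ) 𝓘(ℝ, E) (f ∘ γ) ⟨0, (1 : ℝ)⟩ = ⟨f (γ 0), modelDeriv f (γ 0) v⟩ := by
  have h1 := mfderiv_comp (0 : ℝ) hf hγ.differentiableAt.mdifferentiableAt
  rw [mfderiv_eq_fderiv] at h1
  have h2 : (mfderiv 𝓘(ℝ, ℝ) 𝓘(ℝ, E) (f ∘ γ) 0 : ℝ →L[ℝ] E) 1 = modelDeriv f (γ 0) v := by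
    refine (congrArg (fun A : ℝ →L[ℝ] E ↦ A 1) h1).trans ?_
    refine congrArg (modelDeriv f (γ 0)) ?_
    exact hγ.deriv
  exact congrArg (fun w ↦ (⟨f (γ 0), w⟩ : TangentBundle 𝓘(ℝ, E) M)) h2

/-- Identifies pulling back by `Φ.symm` with pushing forward by `Φ`, so that regularity of pullback
fields yields that of related fields. -/
theorem PartialDiffeomorph.mfderiv_symm_inverse {y : E} (hy : y ∈ Φ.source) (v : E) :
    (mfderiv 𝓘(ℝ, E) 𝓘(ℝ, E) Φ.symm (Φ y) : E →L[ℝ] E).inverse v = modelDeriv Φ y v := by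
  have hΦy : Φ y ∈ Φ.target := Φ.map_source hy
  have hsymm : MDifferentiableAt 𝓘(ℝ, E) 𝓘(ℝ, E) Φ.symm (Φ y) :=
    (Φ.contMDiffOn_invFun.contMDiffAt (Φ.open_target.mem_nhds hΦy)).mdifferentiableAt (by simp)
  have hΦmd : MDifferentiableAt 𝓘(ℝ, E) 𝓘(ℝ, E) Φ y :=
    (PartialDiffeomorph.contMDiffAt hy).mdifferentiableAt (by simp)
  have h1 := mfderiv_comp y hsymm hΦmd
  have h2 : Φ.symm ∘ Φ =ᶠ[𝓝 y] id := by
    filter_upwards [Φ.open_source.mem_nhds hy] with w hw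
    exact Φ.left_inv hw
  rw [h2.mfderiv_eq, mfderiv_id] at h1
  set B : E →L[ℝ] E := mfderiv 𝓘(ℝ, E) 𝓘(ℝ, E) Φ.symm (Φ y) with hB
  have h3 : B ∘L modelDeriv Φ y = ContinuousLinearMap.id ℝ E := h1.symm
  obtain ⟨A, hA⟩ := PartialDiffeomorph.isInvertible_modelDeriv hy
  have h4 : B = A.symm := by
    ext w
    obtain ⟨z, rfl⟩ := A.surjective w
    have := congrArg (fun L : E →L[ℝ] E ↦ L z) h3
    rw [← hA] at this
    simpa using this
  have h5 : B.inverse = modelDeriv Φ y := by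
    rw [h4, ← hA, ContinuousLinearMap.inverse_equiv]
    rfl
  exact congrArg (fun L : E →L[ℝ] E ↦ L v) h5

variable [IsManifold 𝓘(ℝ, E) ∞ M] [CompleteSpace E]

/-- A vector field which is `Φ`-related to a differentiable vector field is differentiable. -/
theorem mdifferentiableAt_of_related {y : E} (hy : y ∈ Φ.source) {X₀ : E → E} {X : VField E M}
    (hX₀ : ContDiffAt ℝ 1 X₀ y) (hX : ∀ᶠ w in 𝓝 y, modelDeriv Φ w (X₀ w) = X (Φ w)) :
    MDifferentiableAt 𝓘(ℝ, E) (𝓘(ℝ, E).prod 𝓘(ℝ, E))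
      (fun x ↦ (⟨x, X x⟩ : TangentBundle 𝓘(ℝ, E) M)) (Φ y) := by
  have hΦy : Φ y ∈ Φ.target := Φ.map_source hy
  have hleft : Φ.symm (Φ y) = y := Φ.left_inv hy
  have : IsManifold 𝓘(ℝ, E) 2 M := IsManifold.of_le (n := ∞) ENat.LEInfty.out
  have hsymm : ContMDiffAt 𝓘(ℝ, E) 𝓘(ℝ, E) ∞ Φ.symm (Φ y) :=
    Φ.contMDiffOn_invFun.contMDiffAt (Φ.open_target.mem_nhds hΦy)
  have hinv : (mfderiv 𝓘(ℝ, E) 𝓘(ℝ, E) Φ.symm (Φ y)).IsInvertible := by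
    have h : IsLocalDiffeomorphAt 𝓘(ℝ, E) 𝓘(ℝ, E) ∞ Φ.symm (Φ y) := ⟨Φ.symm, hΦy, fun _ _ ↦ rfl⟩
    exact ⟨h.mfderivToContinuousLinearEquiv (by simp), rfl⟩
  have hX₀' : MDifferentiableAt 𝓘(ℝ, E) (𝓘(ℝ, E).prod 𝓘(ℝ, E))
      (fun x ↦ (⟨x, X₀ x⟩ : TangentBundle 𝓘(ℝ, E) E)) (Φ.symm (Φ y)) := by
    rw [hleft]
    exact (contMDiffAt_vectorSpace_iff_contDiffAt.2 hX₀).mdifferentiableAt one_ne_zero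
  have key := MDifferentiableAt.mpullback_vectorField hX₀' hsymm hinv ENat.LEInfty.out
  refine key.congr_of_eventuallyEq ?_
  have hcont : ContinuousAt Φ.symm (Φ y) := hsymm.continuousAt
  rw [ContinuousAt, hleft] at hcont
  filter_upwards [hcont.eventually hX, Φ.open_target.mem_nhds hΦy] with q hq hqt
  have h1 : Φ (Φ.symm q) = q := Φ.right_inv hqt
  have h2 : ∀ q', Φ (Φ.symm q) = q' → X q' =
      VectorField.mpullback 𝓘(ℝ, E) 𝓘(ℝ, E) Φ.symm X₀ q' := by
    rintro _ rfl
    refine hq.symm.trans ?_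
    refine (PartialDiffeomorph.mfderiv_symm_inverse (Φ.map_target hqt) _).symm.trans ?_
    have h3 : Φ.symm (Φ (Φ.symm q)) = Φ.symm q := congrArg Φ.symm h1
    exact (congrArg (fun v : E ↦ (mfderiv 𝓘(ℝ, E) 𝓘(ℝ, E) Φ.symm (Φ (Φ.symm q)) :
      E →L[ℝ] E).inverse (X₀ v)) h3).symm
  exact congrArg (fun v ↦ (⟨q, v⟩ : TangentBundle 𝓘(ℝ, E) M)) (h2 q h1)

/-- The Lie bracket of `Φ`-related vector fields. -/
theorem mlieBracket_of_related {y : E} (hy : y ∈ Φ.source) {X₀ Y₀ : E → E} {X Y : VField E M}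
    (hX₀ : ContDiffAt ℝ 1 X₀ y) (hX : ∀ᶠ w in 𝓝 y, modelDeriv Φ w (X₀ w) = X (Φ w))
    (hY₀ : ContDiffAt ℝ 1 Y₀ y) (hY : ∀ᶠ w in 𝓝 y, modelDeriv Φ w (Y₀ w) = Y (Φ w)) :
    (VectorField.mlieBracket 𝓘(ℝ, E) X Y (Φ y) : E) =
      modelDeriv Φ y (VectorField.lieBracket ℝ X₀ Y₀ y) := by
  have : IsManifold 𝓘(ℝ, E) (minSmoothness ℝ 3) M :=
    IsManifold.of_le (n := ∞) (by simpa using ENat.LEInfty.out)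
  have pull : ∀ (Z₀ : E → E) (Z : VField E M), (∀ᶠ w in 𝓝 y, modelDeriv Φ w (Z₀ w) = Z (Φ w)) →
      VectorField.mpullback 𝓘(ℝ, E) 𝓘(ℝ, E) Φ Z =ᶠ[𝓝 y] Z₀ := by
    intro Z₀ Z hZ
    filter_upwards [hZ, Φ.open_source.mem_nhds hy] with w hw hws
    refine (congrArg (modelDeriv Φ w).inverse hw.symm).trans ?_
    exact (PartialDiffeomorph.isInvertible_modelDeriv hws).inverse_apply_self _
  have h1 := VectorField.mpullback_mlieBracket (mdifferentiableAt_of_related hy hX₀ hX)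
    (mdifferentiableAt_of_related hy hY₀ hY) (PartialDiffeomorph.contMDiffAt hy)
    (by simpa using ENat.LEInfty.out)
  have h2 := (pull X₀ X hX).mlieBracket_vectorField_eq (pull Y₀ Y hY)
  have h3 : (VectorField.mlieBracket 𝓘(ℝ, E) X₀ Y₀ y : E) = VectorField.lieBracket ℝ X₀ Y₀ y := by
    rw [← VectorField.lieBracketWithin_univ]
    exact congrFun (VectorField.mlieBracketWithin_eq_lieBracketWithin (s := Set.univ)) y
  refine Eq.trans ?_ (congrArg (modelDeriv Φ y) ((h1.trans h2).trans h3))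
  exact ((PartialDiffeomorph.isInvertible_modelDeriv hy).self_apply_inverse _).symm

end Related

/-! ### The bracket with `B` and tangency to the hyperboloids. -/

section Main

variable {E : Type*} [NormedAddCommGroup E] [NormedSpace ℝ E] [FiniteDimensional ℝ E]
  {M : Type*} [TopologicalSpace M] [ChartedSpace E M] [IsManifold 𝓘(ℝ, E) ∞ M]
  {g : LorentzMetric E M} {O : M} {e : Module.Basis (Fin 4) ℝ (TangentSpace 𝓘(ℝ, E) O)}
  {Φ : PartialDiffeomorph 𝓘(ℝ, E) 𝓘(ℝ, E) E M ∞}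

/-- Along `A y` the radius is stationary, so the derivative of `y / ρ` there is `A y / ρ`, which is
also `A` applied to `y / ρ`; the two terms of the bracket cancel. -/
theorem IsConeChart.mlieBracket_eq_zero [T2Space M] (h : IsConeChart g e Φ)
    (he : ∀ a b : Fin 4, g.val O (e a) (e b) = eta a b) {y : E} (hy : y ∈ Φ.source) (i : Fin 3) :
    VectorField.mlieBracket 𝓘(ℝ, E) (normalB g e) (boost g e i) (Φ y) = 0 := by
  have : CompleteSpace E := FiniteDimensional.complete ℝ E
  have hpos := formAt_self_neg_of_mem_hypCone he (h.subset_cone hy)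
  obtain ⟨L, hL, hd⟩ := hasFDerivAt_unitRadial (formAt_symm g O) hpos
  have hsrc := Φ.open_source.mem_nhds hy
  have h1 := mlieBracket_of_related hy (contDiffAt_unitRadial hpos)
    (by filter_upwards [hsrc] with w hw using h.normalB_eq he hw)
    (boostMap (E := E) e i).contDiff.contDiffAt
    (by filter_upwards [hsrc] with w hw using h.boost_eq hw i)
  refine h1.trans ?_
  have h2 : VectorField.lieBracket ℝ (fun w ↦ (radius (formAt g O) w)⁻¹ • w)
      (boostMap (E := E) e i) y = 0 := by
    rw [VectorField.lieBracket, hd.fderiv, (boostMap (E := E) e i).fderiv]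
    simp [hL _ (formAt_boostMap_self he i y)]
  exact (congrArg (modelDeriv Φ y) h2).trans (map_zero _)

theorem IsConeChart.isTangentTo_boost (h : IsConeChart g e Φ)
    (he : ∀ a b : Fin 4, g.val O (e a) (e b) = eta a b) {r : ℝ} {V : E} (hV : V ∈ unitHyp e)
    (hy : r • V ∈ Φ.source) (i : Fin 3) :
    IsTangentTo (hyp g e r) (Φ (r • V)) (boost g e i (Φ (r • V))) := by
  set A := boostMap (E := E) e i with hA
  set q := formAt g O (A V) (A V) with hq
  set N := normalizedLine V (A V) q with hN
  have hN0 : N 0 = V := normalizedLine_zero _ _ _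
  have hNs : ContDiffAt ℝ ∞ N 0 := contDiffAt_normalizedLine _ _ _
  have hunit : ∀ᶠ t in 𝓝 (0 : ℝ), N t ∈ unitHyp e := by
    have hc : Continuous fun w : E ↦ comp e w 0 :=
      continuous_basis_repr (E := E) e 0
    have h1 : ∀ᶠ t in 𝓝 (0 : ℝ), 0 < comp e (N t) 0 :=
      (hc.continuousAt.comp hNs.continuousAt).eventually
        (lt_mem_nhds (by rw [Function.comp_apply, hN0]; exact hV.1))
    have h2 : ∀ᶠ t in 𝓝 (0 : ℝ), 0 < 1 - t ^ 2 * q :=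
      (show Continuous fun t : ℝ ↦ 1 - t ^ 2 * q by fun_prop).continuousAt.eventually
        (lt_mem_nhds (by simp))
    filter_upwards [h1, h2] with t ht1 ht2
    refine ⟨ht1, ?_⟩
    -- The linear term drops out because `η(V, A V) = 0`; this is the source of the factor in
    -- `normalizedLine`.
    have h3 : minkSq e (V + t • A V) = 1 - t ^ 2 * q := by
      have h4 := hV.2
      rw [minkSq_eq he] at h4 ⊢
      change -formAt g O V V = 1 at h4
      change -formAt g O (V + t • A V) (V + t • A V) = _
      have h5 := formAt_boostMap_self he i V
      have h6 := formAt_symm g O (A V) V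
      simp only [map_add, map_smul, add_apply, smul_apply, smul_eq_mul, h6]
      rw [h5, ← hq]
      linarith
    rw [hN, normalizedLine, minkSq_smul, h3, inv_pow, Real.sq_sqrt ht2.le]
    exact inv_mul_cancel₀ ht2.ne'
  have hγ0 : r • N 0 = r • V := by rw [hN0]
  have hγd : HasDerivAt (fun t ↦ r • N t) (r • A V) 0 :=
    (hasDerivAt_normalizedLine _ _ _).const_smul r
  have hγs : ContDiffAt ℝ ∞ (fun t ↦ r • N t) 0 := contDiffAt_const.smul hNs
  have hΦ : ContMDiffAt 𝓘(ℝ, E) 𝓘(ℝ, E) ∞ Φ (r • N 0) := by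
    rw [hγ0]
    exact PartialDiffeomorph.contMDiffAt hy
  refine ⟨Φ ∘ fun t ↦ r • N t, hΦ.comp (0 : ℝ) hγs.contMDiffAt, ?_, ?_⟩
  · have hsrc : ∀ᶠ t in 𝓝 (0 : ℝ), r • N t ∈ Φ.source :=
      hγs.continuousAt.eventually
        (Φ.open_source.mem_nhds (show r • N 0 ∈ Φ.source from hγ0.symm ▸ hy))
    filter_upwards [hunit, hsrc] with t ht1 ht2
    exact ⟨N t, ht1, (h.eqOn ht2).symm⟩
  · refine (tangentMap_comp_curve hγd (hΦ.mdifferentiableAt (by simp))).trans ?_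
    have h1 : ∀ z : E, z = r • V → (⟨Φ z, modelDeriv Φ z (r • A V)⟩ : TangentBundle 𝓘(ℝ, E) M) =
        ⟨Φ (r • V), boost g e i (Φ (r • V))⟩ := by
      rintro _ rfl
      have h2 := h.boost_eq hy i
      rw [map_smul] at h2
      exact congrArg (fun w ↦ (⟨Φ (r • V), w⟩ : TangentBundle 𝓘(ℝ, E) M)) h2
    exact h1 _ hγ0

end Main

end HyperboloidBoost

end

/-! ### Assembly: each point is placed in a cone chart. -/

theorem proposition2p20p18p16 {E : Type*} [NormedAddCommGroup E] [NormedSpace ℝ E]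
    {M : Type*} [TopologicalSpace M] [T2Space M] [ChartedSpace E M] [IsManifold 𝓘(ℝ, E) ∞ M]
    (hdim : Module.finrank ℝ E = 4)
    (g : HyperboloidBoost.LorentzMetric E M) (O : M)
    (e : Module.Basis (Fin 4) ℝ (TangentSpace 𝓘(ℝ, E) O))
    (he : ∀ a b : Fin 4, g.val O (e a) (e b) = HyperboloidBoost.eta a b) :
    (∀ i : Fin 3, ∀ p ∈ HyperboloidBoost.futureStar g e,
      VectorField.mlieBracket 𝓘(ℝ, E)
        (HyperboloidBoost.normalB g e) (HyperboloidBoost.boost g e i) p = 0) ∧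
    (∀ i : Fin 3, ∀ r : ℝ, 0 < r → ENNReal.ofReal r < HyperboloidBoost.injRadius g e →
      ∀ p ∈ HyperboloidBoost.hyp g e r,
        HyperboloidBoost.IsTangentTo (HyperboloidBoost.hyp g e r) p
          (HyperboloidBoost.boost g e i p)) ∧
    (∀ j : Fin 3, ∀ l : List (Fin 3), ∀ p ∈ HyperboloidBoost.futureStar g e,
      HyperboloidBoost.iterLie g e l
          (HyperboloidBoost.deformation g (HyperboloidBoost.boost g e j)) p
          (HyperboloidBoost.normalB g e p) (HyperboloidBoost.normalB g e p) = 0 ∧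
      ∀ i : Fin 3,
        HyperboloidBoost.iterLie g e l
          (HyperboloidBoost.deformation g (HyperboloidBoost.boost g e j)) p
          (HyperboloidBoost.normalB g e p) (HyperboloidBoost.boost g e i p) = 0) := by
  have : FiniteDimensional ℝ E := FiniteDimensional.of_finrank_pos (by rw [hdim]; norm_num)
  have chart : ∀ p ∈ HyperboloidBoost.futureStar g e,
      ∃ Φ, HyperboloidBoost.IsConeChart g e Φ ∧ ∃ y ∈ Φ.source, Φ y = p := by
    rintro _ ⟨_, ⟨r, V, hV, hr0, hr, rfl⟩, rfl⟩
    obtain ⟨Φ, h, hy⟩ := HyperboloidBoost.exists_isConeChart hV hr0 hr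
    exact ⟨Φ, h, _, hy, h.eqOn hy⟩
  refine ⟨fun i p hp ↦ ?_, fun i r hr0 hr p hp ↦ ?_, fun j l p hp ↦ ?_⟩
  · obtain ⟨Φ, h, y, hy, rfl⟩ := chart p hp
    exact h.mlieBracket_eq_zero he hy i
  · obtain ⟨V, hV, rfl⟩ := hp
    obtain ⟨Φ, h, hy⟩ := HyperboloidBoost.exists_isConeChart hV hr0 hr
    have h1 := h.isTangentTo_boost he hV hy i
    rwa [h.eqOn hy] at h1
  · obtain ⟨Φ, h, y, hy, rfl⟩ := chart p hp
    exact ⟨h.iterLie_eq_zero he j l hy _, fun i ↦ h.iterLie_eq_zero he j l hy _⟩
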